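/- Work in $\mathbb P^2(\mathbb C)$. For a finite set $A$ of lines let $t_k(A)$ be the number of its $k$-points, i.e. points lying on exactly $k$ lines of $A$; for a set $C$ of lines let $\check C$ be the set of lines of the dual plane that contain at least two of the points dual to the lines in $C$. A set $C$ of six lines is an *unassuming arrangement* if its only singularities (points on at least two lines) are $15$ double points, if $\check C$ has $t_2=27$, $t_3=6$, $t_5=6$ and no other singularities, and if the six $5$-points of $\check C$ do not lie on a conic. For $z\in\mathbb C\setminus S$, $S=\{-1,0,1,\pm2\pm\sqrt5\}$, let $\mathcal C_0(z)$ be the labelled arrangement of the six lines with normals $(1,0,0)$, $(0,1,0)$, $(0,0,1)$, $(1,1,1)$, $(z+1,-z+1,2)$, $(-z+1,z+1,2)$. The family $\mathfrak B_6/S_6$ consists of the arrangements which, forgetting the labels, are projectively equivalent to some $\mathcal C_0(z)$, $z\in\mathbb C\setminus S$. For a set $\mathrm{NB}$ of triples in $\{1,\dots,15\}$ consider the rank-three matroid on $\{1,\dots,15\}$ whose non-bases are the triples in $\mathrm{NB}$ and all triples contained in one of the quintuples $(1,2,8,9,12)$, $(1,6,7,13,15)$, $(2,3,5,6,14)$,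 $(3,4,7,10,12)$, $(4,5,9,11,15)$, $(8,10,11,13,14)$. A realization is a $15$-tuple of lines such that the normals of three lines with distinct labels are linearly dependent exactly when the labels form a non-basis. Its realization space is the set of realizations over $\mathbb C$ modulo projective equivalence of labelled arrangements; an arrangement $C$ is said to belong to it if $C$ is the set of lines dual to the $5$-points of some realization. Put $$\mathrm{NB}_1=\{(1,5,10),(2,4,13),(3,9,13),(5,7,8),(6,11,12),(12,14,15)\},$$ $$\mathrm{NB}_2=\{(1,3,11),(1,4,14),(3,8,15),(4,6,8),(6,11,12),(12,14,15)\}.$$ **Proposition.** (1) Every unassuming arrangement either lies in the family $\mathfrak B_6/S_6$ and belongs to the realization space given by $\mathrm{NB}_1$, or belongs to the realization space given by $\mathrm{NB}_2$. (2) The first family is one-dimensional: for distinct $z,z'\in\mathbb C\setminus S$ the labelled arrangements $\mathcal C_0(z)$ and $\mathcal C_0(z')$ are not projectively equivalent as labelled arrangements. (3) The second moduli space is rigid and corresponds to the Hesse-type arrangement: the realization space given by $\mathrm{NB}_2$ consists of exactly two points. Moreover, for every $j\in\mathbb C$ with $j^2+j+1=0$, an arrangement belongs to it if and only if it is projectively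 equivalent to the arrangement of the six lines with normals $(1,0,0)$, $(0,1,0)$, $(0,0,1)$, $(1,1,1)$, $(-j,j+1,1)$, $(\tfrac13(1-j),\tfrac13(j+2),1)$. This last arrangement is projectively equivalent to a set of lines contained in the Hesse arrangement of the twelve lines with normals $(1,0,0)$, $(0,1,0)$, $(0,0,1)$ and $(1,j^a,j^b)$, $0\le a,b\le2$. -/

import Mathlib

namespace Unassuming

/-! Points and lines of the complex projective plane. A line is given by its normal, that is,
by the corresponding point of the dual plane, so that points and lines have the same type and
projective duality is the identity on homogeneous coordinates. -/

/-- The points of the complex projective plane. -/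
abbrev Point : Type := Projectivization ℂ (Fin 3 → ℂ)

/-- The lines of the complex projective plane, given by their normals. -/
abbrev Line : Type := Projectivization ℂ (Fin 3 → ℂ)

/-- The point `p` lies on the line `l`. -/
def Incident (p : Point) (l : Line) : Prop := Projectivization.orthogonal p l

/-- The set of lines dual to a set of points. -/
def dualLines (P : Set Point) : Set Line := P

/-- The set of points dual to a set of lines. -/
def dualPoints (A : Set Line) : Set Point := A

/-- The number of lines of `A` through `p`. -/
noncomputable def multiplicity (A : Set Line) (p : Point) : ℕ := {l | l ∈ A ∧ Incident p l}.ncard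

/-- The `k`-points of `A`: the points where exactly `k` lines of `A` meet. -/
def kPoints (k : ℕ) (A : Set Line) : Set Point := {p | multiplicity A p = k}

/-- The number `t_k(A)` of `k`-points of `A`. -/
noncomputable def t (k : ℕ) (A : Set Line) : ℕ := (kPoints k A).ncard

/-- The lines containing at least `k` points of `P`. -/
def linesThrough (k : ℕ) (P : Set Point) : Set Line := {l | k ≤ {p | p ∈ P ∧ Incident p l}.ncard}

/-- The arrangement of the lines through at least two of the points dual to `C`. -/
def check (C : Set Line) : Set Line := linesThrough 2 (dualPoints C)

/-- The points of `P` lie on a common (possibly degenerate) conic. -/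
def OnConic (P : Set Point) : Prop :=
  ∃ Q : QuadraticForm ℂ (Fin 3 → ℂ), Q ≠ 0 ∧ ∀ p ∈ P, Q p.rep = 0

/-- Unassuming arrangements of six lines. -/
structure IsUnassuming (C : Set Line) : Prop where
  card_lines : C.ncard = 6
  t_two : t 2 C = 15
  singularities : ∀ p, 2 ≤ multiplicity C p → multiplicity C p = 2
  check_t_two : t 2 (check C) = 27
  check_t_three : t 3 (check C) = 6
  check_t_five : t 5 (check C) = 6
  check_singularities : ∀ p, 2 ≤ multiplicity (check C) p →
    multiplicity (check C) p = 2 ∨ multiplicity (check C) p = 3 ∨ multiplicity (check C) p = 5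
  not_onConic : ¬ OnConic (kPoints 5 (check C))

/-- The action of a linear automorphism on the projective plane of points or of lines. -/
noncomputable def act (h : (Fin 3 → ℂ) ≃ₗ[ℂ] (Fin 3 → ℂ)) :
    Projectivization ℂ (Fin 3 → ℂ) → Projectivization ℂ (Fin 3 → ℂ) :=
  Projectivization.map h.toLinearMap h.injective

theorem act_mk (h : (Fin 3 → ℂ) ≃ₗ[ℂ] (Fin 3 → ℂ)) (v : Fin 3 → ℂ) (hv : v ≠ 0) :
    act h (Projectivization.mk ℂ v hv) =
      Projectivization.mk ℂ (h v) (by simpa using hv) := rfl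

/-- Every linear automorphism acting on normals is induced by a projective transformation of
the points (the contragredient one). By symmetry of `Incident`, every projective transformation
of the points likewise induces a linear automorphism on normals. -/
theorem exists_contragredient (h : (Fin 3 → ℂ) ≃ₗ[ℂ] (Fin 3 → ℂ)) :
    ∃ g : (Fin 3 → ℂ) ≃ₗ[ℂ] (Fin 3 → ℂ),
      ∀ (p : Point) (l : Line), Incident (act g p) (act h l) ↔ Incident p l := by
  let H := LinearMap.toMatrix' h.toLinearMap
  let K := LinearMap.toMatrix' h.symm.toLinearMap
  have hKH : K * H = 1 := by
    rw [← LinearMap.toMatrix'_comp]; simp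
  have hHK : H * K = 1 := by
    rw [← LinearMap.toMatrix'_comp]; simp
  have hT : K.transpose * H.transpose = 1 := by
    rw [← Matrix.transpose_mul, hHK, Matrix.transpose_one]
  have hT' : H.transpose * K.transpose = 1 := by
    rw [← Matrix.transpose_mul, hKH, Matrix.transpose_one]
  refine ⟨Matrix.toLin'OfInv hT' hT, fun p l => ?_⟩
  induction p using Projectivization.ind with | h v hv =>
  induction l using Projectivization.ind with | h w hw =>
  have hh : h w = H.mulVec w := by
    rw [← Matrix.toLin'_apply]; simp [H]
  simp only [act, Incident, Projectivization.map_mk, Projectivization.orthogonal_mk]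
  have : (dotProduct (K.transpose.mulVec v) (H.mulVec w)) = dotProduct v w := by
    rw [Matrix.mulVec_transpose, ← Matrix.dotProduct_mulVec, Matrix.mulVec_mulVec, hKH,
      Matrix.one_mulVec]
  rw [← this, ← hh]
  rfl

/-- Projective equivalence of (unlabelled) line arrangements. -/
def ProjEquiv (A B : Set Line) : Prop :=
  ∃ h : (Fin 3 → ℂ) ≃ₗ[ℂ] (Fin 3 → ℂ), act h '' A = B

/-- Projective equivalence of labelled line arrangements. -/
def LabelledEquiv {ι : Type} (L L' : ι → Line) : Prop :=
  ∃ h : (Fin 3 → ℂ) ≃ₗ[ℂ] (Fin 3 → ℂ), ∀ i, act h (L i) = L' i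

/-! The two matroids of rank three on fifteen elements. The elements are the labels
`1, …, 15`, read modulo fifteen (so that `15` is `0` in `Fin 15`). -/

/-- The labels of the six quintuples of concurrent lines. -/
def quintuples : Finset (Finset (Fin 15)) :=
  {{1, 2, 8, 9, 12}, {1, 6, 7, 13, 15}, {2, 3, 5, 6, 14},
   {3, 4, 7, 10, 12}, {4, 5, 9, 11, 15}, {8, 10, 11, 13, 14}}

/-- The labels of the triple points, for the first matroid. -/
def NB₁ : Finset (Finset (Fin 15)) :=
  {{1, 5, 10}, {2, 4, 13}, {3, 9, 13}, {5, 7, 8}, {6, 11, 12}, {12, 14, 15}}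

/-- The labels of the triple points, for the second matroid. -/
def NB₂ : Finset (Finset (Fin 15)) :=
  {{1, 3, 11}, {1, 4, 14}, {3, 8, 15}, {4, 6, 8}, {6, 11, 12}, {12, 14, 15}}

/-- The non-bases of the matroid given by `NB`: the elements of `NB`, and the triples contained
in one of the quintuples. -/
def IsNonbasis (NB : Finset (Finset (Fin 15))) (s : Finset (Fin 15)) : Prop :=
  s.card = 3 ∧ (s ∈ NB ∨ ∃ q ∈ quintuples, s ⊆ q)

/-- A realization over `ℂ` of the matroid given by `NB`, as a tuple of lines: the normals of
three lines are linearly dependent exactly when their labels form a non-basis. -/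
def IsRealization (NB : Finset (Finset (Fin 15))) (L : Fin 15 → Line) : Prop :=
  ∀ i j k, i ≠ j → i ≠ k → j ≠ k →
    (Projectivization.Dependent ![L i, L j, L k] ↔ IsNonbasis NB {i, j, k})

/-- Projective equivalence on the realizations of a matroid. -/
def realizationSetoid (NB : Finset (Finset (Fin 15))) :
    Setoid {L : Fin 15 → Line // IsRealization NB L} where
  r L L' := LabelledEquiv L.1 L'.1
  iseqv := by
    refine ⟨fun L => ⟨LinearEquiv.refl ℂ _, fun i => ?_⟩, ?_, ?_⟩
    · exact congrFun Projectivization.map_id (L.1 i)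
    · rintro L L' ⟨h, hh⟩
      refine ⟨h.symm, fun i => ?_⟩
      rw [← hh i]
      generalize L.1 i = l
      induction l using Projectivization.ind with | h v hv => simp [act_mk]
    · rintro L L' L'' ⟨h, hh⟩ ⟨g, hg⟩
      refine ⟨h.trans g, fun i => ?_⟩
      rw [← hg i, ← hh i]
      generalize L.1 i = l
      induction l using Projectivization.ind with | h v hv => simp [act_mk]

/-- The realization space of the matroid given by `NB`: its realizations over `ℂ` up to
projective equivalence. -/
def RealizationSpace (NB : Finset (Finset (Fin 15))) : Type := Quotient (realizationSetoid NB)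

/-- `C` belongs to the moduli space given by `NB`: there is a realization of the matroid such
that `C` is dual to the set of its points of multiplicity five. -/
def InModuli (NB : Finset (Finset (Fin 15))) (C : Set Line) : Prop :=
  ∃ L : Fin 15 → Line, IsRealization NB L ∧ C = dualLines (kPoints 5 (Set.range L))

/-- The normals of the six lines of `𝒞₀(z)`. -/
noncomputable def familyNormal (z : ℂ) : Fin 6 → Fin 3 → ℂ :=
  ![![1, 0, 0], ![0, 1, 0], ![0, 0, 1], ![1, 1, 1], ![z + 1, -z + 1, 2], ![-z + 1, z + 1, 2]]

theorem familyNormal_ne_zero (z : ℂ) (i : Fin 6) : familyNormal z i ≠ 0 := by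
  fin_cases i <;> simp [familyNormal]

/-- The labelled arrangement `𝒞₀(z)`. -/
noncomputable def familyLine (z : ℂ) (i : Fin 6) : Line :=
  Projectivization.mk ℂ (familyNormal z i) (familyNormal_ne_zero z i)

/-- The excluded finite parameters; the point at infinity of the parameter line is excluded too,
since the parameter is a complex number. -/
noncomputable def excluded : Set ℂ :=
  {-1, 0, 1, 2 + ((√5 : ℝ) : ℂ), 2 - ((√5 : ℝ) : ℂ), -2 + ((√5 : ℝ) : ℂ), -2 - ((√5 : ℝ) : ℂ)}

/-- `C` belongs to the family `𝔅₆ / S₆`: up to projective equivalence and forgetting the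
labels, it is one of the arrangements `𝒞₀(z)`. -/
def InB6 (C : Set Line) : Prop :=
  ∃ z : ℂ, z ∉ excluded ∧ ProjEquiv C (Set.range (familyLine z))

/-- The normals of the six lines of the Hesse-type arrangement, for a primitive cube root of
unity `j`. -/
noncomputable def hesseTypeNormal (j : ℂ) : Fin 6 → Fin 3 → ℂ :=
  ![![1, 0, 0], ![0, 1, 0], ![0, 0, 1], ![1, 1, 1], ![-j, j + 1, 1],
    ![(1 - j) / 3, (j + 2) / 3, 1]]

theorem hesseTypeNormal_ne_zero (j : ℂ) (i : Fin 6) : hesseTypeNormal j i ≠ 0 := by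
  fin_cases i <;> simp [hesseTypeNormal]

/-- The Hesse-type arrangement of six lines. -/
noncomputable def hesseType (j : ℂ) : Set Line :=
  Set.range fun i => Projectivization.mk ℂ (hesseTypeNormal j i) (hesseTypeNormal_ne_zero j i)

/-- The Hesse arrangement of twelve lines, for a primitive cube root of unity `j`: the lines with
normals `(1, 0, 0)`, `(0, 1, 0)`, `(0, 0, 1)` and `(1, jᵃ, jᵇ)`. -/
def hesseArrangement (j : ℂ) : Set Line :=
  {l | ∃ (v : Fin 3 → ℂ) (hv : v ≠ 0), l = Projectivization.mk ℂ v hv ∧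
    (v = ![1, 0, 0] ∨ v = ![0, 1, 0] ∨ v = ![0, 0, 1] ∨ ∃ a b : ℕ, v = ![1, j ^ a, j ^ b])}

end Unassuming

/-!
Unassuming arrangements are studied through the dual picture: six points `P 0, …, P 5`, no three of
them collinear, and their fifteen joins. A point other than the `P i` lies on joins with disjoint
pairs of ends, hence on at most three of them, and the triple points correspond to those of the
fifteen perfect matchings of the six points whose three edges are concurrent lines
(`Generic.ncard_kPoints_three`). So an unassuming arrangement has exactly six concurrent matchings.

The combinatorics rests on Pappus' theorem in the form that two triangles in perspective in two
cyclically different ways are in perspective in the third way (`Generic.pappus`). If two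
matchings without a common edge are concurrent, then so is the conjugate of one by the other. Under
the outer automorphism of the symmetric group on six letters, matchings become pairs of elements of
a set of six elements, and the closure under conjugation says that the concurrent ones form an
equivalence relation. An equivalence relation on six elements with exactly six related pairs has
classes of sizes 4, 1, 1 or of sizes 3, 3 (`classification`), and these are the matroids given by
`NB₁` and `NB₂`.

In the first case the concurrency conditions in a projective frame leave one free parameter, and
the six points are those of the family; the parameters `±2 ± √5` are excluded because a further
matching becomes concurrent there (`Generic.inB6`). In the second case the points form two triangles
that are in perspective in all six ways. With one of them as coordinate triangle and a vertex of the
other as unit point, the remaining points are `(ω, ω², 1)` and `(ω², ω, 1)` for a primitive cube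
root of unity `ω` (`Generic.exists_hessePoint`). The two values of `ω` are the two points of the
realization space; exchanging two of the six points exchanges them, so that they give the same
unlabelled arrangement.

Conversely, every realization of one of the matroids consists of the joins of its six points of
multiplicity five (`IsRealization.exists_generic`), and six points with the prescribed concurrent
matchings give a realization (`Generic.isRealization_joins`).
-/

namespace Unassuming

/-! ### Incidence in coordinates -/

/-- The determinant of three vectors, in terms of their coordinates. -/
def bracket (x y z : Fin 3 → ℂ) : ℂ :=
  x 0 * (y 1 * z 2 - y 2 * z 1) + x 1 * (y 2 * z 0 - y 0 * z 2) + x 2 * (y 0 * z 1 - y 1 * z 0)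

theorem bracket_eq_dotProduct_cross (x y z : Fin 3 → ℂ) :
    bracket x y z = dotProduct x (crossProduct y z) := by
  simp [bracket, cross_apply, dotProduct, Fin.sum_univ_three]

theorem bracket_eq_det (x y z : Fin 3 → ℂ) : bracket x y z = (Matrix.of ![x, y, z]).det := by
  rw [bracket_eq_dotProduct_cross]
  exact triple_product_eq_det x y z

theorem incident_comm {p l : Point} : Incident p l ↔ Incident l p :=
  Projectivization.orthogonal_comm

theorem eq_or_eq_of_incident {p q : Point} {l m : Line} (hpl : Incident p l) (hql : Incident q l)
    (hpm : Incident p m) (hqm : Incident q m) : p = q ∨ l = m :=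
  Configuration.ofField.eq_or_eq_of_orthogonal hpl hql hpm hqm

theorem exists_incident_mk_iff_bracket_eq_zero {a b c : Fin 3 → ℂ} (ha : a ≠ 0) (hb : b ≠ 0)
    (hc : c ≠ 0) :
    (∃ l : Line, Incident (Projectivization.mk ℂ a ha) l ∧
      Incident (Projectivization.mk ℂ b hb) l ∧ Incident (Projectivization.mk ℂ c hc) l) ↔
      bracket a b c = 0 := by
  rw [bracket_eq_det, ← Matrix.exists_mulVec_eq_zero_iff]
  constructor
  · rintro ⟨l, h⟩
    induction l using Projectivization.ind with | h v hv =>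
    refine ⟨v, hv, ?_⟩
    ext i
    fin_cases i
    · exact h.1
    · exact h.2.1
    · exact h.2.2
  · rintro ⟨v, hv, h⟩
    exact ⟨Projectivization.mk ℂ v hv, congrFun h 0, congrFun h 1, congrFun h 2⟩

theorem exists_line_through (p q : Point) : ∃ l : Line, Incident p l ∧ Incident q l := by
  induction p using Projectivization.ind with | h v hv =>
  induction q using Projectivization.ind with | h w hw =>
  obtain ⟨l, hl, -, hl'⟩ :=
    (exists_incident_mk_iff_bracket_eq_zero hv hv hw).2 (by simp only [bracket]; ring)
  exact ⟨l, hl, hl'⟩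

/-- Lines are concurrent exactly when their normals are linearly dependent. -/
theorem dependent_iff_concurrent (l m n : Line) :
    Projectivization.Dependent ![l, m, n] ↔
      ∃ x : Point, Incident x l ∧ Incident x m ∧ Incident x n := by
  rw [← Projectivization.mk_rep l, ← Projectivization.mk_rep m, ← Projectivization.mk_rep n]
  have h := exists_incident_mk_iff_bracket_eq_zero l.rep_nonzero m.rep_nonzero n.rep_nonzero
  refine Iff.trans ?_ (h.symm.trans (exists_congr fun x => by simp only [incident_comm (l := x)]))
  simp only [Projectivization.mk_rep]
  rw [Projectivization.dependent_iff, bracket_eq_det,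
    not_iff_comm, ← ne_eq, ← isUnit_iff_ne_zero, ← Matrix.isUnit_iff_isUnit_det,
    ← Matrix.linearIndependent_rows_iff_isUnit]
  have : Matrix.row (Matrix.of ![l.rep, m.rep, n.rep]) =
      Projectivization.rep ∘ ![l, m, n] := by
    ext i j
    fin_cases i <;> rfl
  rw [this]

/-! ### Six points in general position and their fifteen joins -/

/-- No three of the six points are collinear. -/
def Generic (P : Fin 6 → Point) : Prop :=
  ∀ i j k, i ≠ j → i ≠ k → j ≠ k →
    ∀ l : Line, Incident (P i) l → Incident (P j) l → ¬ Incident (P k) l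

/-- The line joining two points; its value is irrelevant when they coincide. -/
noncomputable def join (p q : Point) : Line := Projectivization.cross p q

theorem join_comm (p q : Point) : join p q = join q p := Projectivization.cross_comm p q

theorem incident_join_left {p q : Point} (h : p ≠ q) : Incident p (join p q) :=
  Projectivization.orthogonal_cross_left h

theorem incident_join_right {p q : Point} (h : p ≠ q) : Incident q (join p q) :=
  Projectivization.orthogonal_cross_right h

theorem eq_join {p q : Point} {l : Line} (h : p ≠ q) (hp : Incident p l) (hq : Incident q l) :
    l = join p q :=
  (eq_or_eq_of_incident hp hq (incident_join_left h) (incident_join_right h)).resolve_left h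

theorem exists_ne_ne (i j : Fin 6) : ∃ k, i ≠ k ∧ j ≠ k := by
  revert i j; decide

theorem Generic.injective {P : Fin 6 → Point} (hP : Generic P) : Function.Injective P := by
  intro i j hij
  by_contra hne
  obtain ⟨k, hik, hjk⟩ := exists_ne_ne i j
  obtain ⟨l, hi, hk⟩ := exists_line_through (P i) (P k)
  exact hP i j k hne hik hjk l hi (hij ▸ hi) hk

theorem Generic.comp {P : Fin 6 → Point} (hP : Generic P) {σ : Fin 6 → Fin 6}
    (hσ : Function.Injective σ) : Generic (P ∘ σ) :=
  fun _ _ _ hij hik hjk => hP _ _ _ (hσ.ne hij) (hσ.ne hik) (hσ.ne hjk)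

theorem Generic.not_incident {P : Fin 6 → Point} (hP : Generic P) {i j k : Fin 6} (hij : i ≠ j)
    (hik : i ≠ k) (hjk : j ≠ k) : ¬ Incident (P k) (join (P i) (P j)) :=
  hP i j k hij hik hjk _ (incident_join_left (hP.injective.ne hij))
    (incident_join_right (hP.injective.ne hij))

/-- The points `P i` and the involution `f` define concurrent lines: all joins of `P i` with
`P (f i)` pass through one point. For `f` without fixed points these are the three lines of a
perfect matching of the six points. -/
def Concurrent (P : Fin 6 → Point) (f : Fin 6 → Fin 6) : Prop :=
  ∃ x : Point, ∀ i, Incident x (join (P i) (P (f i)))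

theorem concurrent_comp_iff (P : Fin 6 → Point) {σ f g : Fin 6 → Fin 6}
    (hσ : Function.Injective σ) (h : ∀ i, σ (f i) = g (σ i)) :
    Concurrent (P ∘ σ) f ↔ Concurrent P g := by
  refine exists_congr fun x => ?_
  simp only [Function.comp_apply, h]
  exact ⟨fun H i => by
    obtain ⟨j, rfl⟩ := (Finite.injective_iff_surjective.mp hσ) i
    exact H j, fun H i => H _⟩

/-! ### Projective transformations -/

theorem act_injective (h : (Fin 3 → ℂ) ≃ₗ[ℂ] (Fin 3 → ℂ)) : Function.Injective (act h) :=
  Projectivization.map_injective _ _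

theorem act_symm_act (h : (Fin 3 → ℂ) ≃ₗ[ℂ] (Fin 3 → ℂ)) (p : Point) :
    act h.symm (act h p) = p := by
  induction p using Projectivization.ind with | h v hv => simp [act_mk]

theorem act_act_symm (h : (Fin 3 → ℂ) ≃ₗ[ℂ] (Fin 3 → ℂ)) (p : Point) :
    act h (act h.symm p) = p := by
  induction p using Projectivization.ind with | h v hv => simp [act_mk]

theorem act_trans (h g : (Fin 3 → ℂ) ≃ₗ[ℂ] (Fin 3 → ℂ)) (p : Point) :
    act (h.trans g) p = act g (act h p) := by
  induction p using Projectivization.ind with | h v hv => simp [act_mk]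

/-- The action on lines induced by a linear automorphism acting on points. -/
theorem exists_act_incident (h : (Fin 3 → ℂ) ≃ₗ[ℂ] (Fin 3 → ℂ)) :
    ∃ g : (Fin 3 → ℂ) ≃ₗ[ℂ] (Fin 3 → ℂ),
      ∀ (p : Point) (l : Line), Incident (act h p) (act g l) ↔ Incident p l := by
  obtain ⟨g, hg⟩ := exists_contragredient h
  exact ⟨g, fun p l => by rw [incident_comm, hg, incident_comm]⟩

theorem act_join {h g : (Fin 3 → ℂ) ≃ₗ[ℂ] (Fin 3 → ℂ)}
    (hg : ∀ (p : Point) (l : Line), Incident (act h p) (act g l) ↔ Incident p l) {p q : Point}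
    (hpq : p ≠ q) : act g (join p q) = join (act h p) (act h q) :=
  eq_join ((act_injective h).ne hpq) ((hg _ _).2 (incident_join_left hpq))
    ((hg _ _).2 (incident_join_right hpq))

theorem Generic.act {P : Fin 6 → Point} (hP : Generic P) (h : (Fin 3 → ℂ) ≃ₗ[ℂ] (Fin 3 → ℂ)) :
    Generic (act h ∘ P) := by
  obtain ⟨g, hg⟩ := exists_act_incident h
  intro i j k hij hik hjk l
  rw [← act_act_symm g l]
  simp only [Function.comp_apply, hg]
  exact hP i j k hij hik hjk _

theorem Generic.concurrent_act_iff {P : Fin 6 → Point} (hP : Generic P)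
    (h : (Fin 3 → ℂ) ≃ₗ[ℂ] (Fin 3 → ℂ)) {f : Fin 6 → Fin 6} (hf : ∀ i, f i ≠ i) :
    Concurrent (Unassuming.act h ∘ P) f ↔ Concurrent P f := by
  obtain ⟨g, hg⟩ := exists_act_incident h
  have key : ∀ x i, Incident (Unassuming.act h x) (join ((Unassuming.act h ∘ P) i)
      ((Unassuming.act h ∘ P) (f i))) ↔ Incident x (join (P i) (P (f i))) := fun x i => by
    rw [Function.comp_apply, Function.comp_apply,
      ← act_join hg (hP.injective.ne (hf i).symm), hg]
  constructor
  · rintro ⟨x, hx⟩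
    refine ⟨Unassuming.act h.symm x, fun i => ?_⟩
    rw [← key, act_act_symm]
    exact hx i
  · rintro ⟨x, hx⟩
    exact ⟨Unassuming.act h x, fun i => (key x i).2 (hx i)⟩

/-! ### The labels of the fifteen joins -/

/-- The first end of the join with a given label. The `i`-th quintuple of labels consists of the
joins through the `i`-th point. -/
def src : Fin 15 → Fin 6 := ![1, 0, 0, 2, 3, 2, 1, 1, 0, 0, 3, 4, 0, 1, 2]

/-- The second end of the join with a given label. -/
def tgt : Fin 15 → Fin 6 := ![4, 1, 2, 3, 4, 4, 2, 3, 5, 4, 5, 5, 3, 5, 5]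

/-- The label of the join of two distinct points; the diagonal is irrelevant. -/
def label : Fin 6 → Fin 6 → Fin 15 :=
  ![![0, 1, 2, 12, 9, 8], ![1, 0, 6, 7, 0, 13], ![2, 6, 0, 3, 5, 14],
    ![12, 7, 3, 0, 4, 10], ![9, 0, 5, 4, 0, 11], ![8, 13, 14, 10, 11, 0]]

/-- The fifteen perfect matchings of six points, as involutions. The matching with index `m`
corresponds, under the outer automorphism of the symmetric group, to the `m`-th pair in the list
`01, 02, 12, 03, 13, 23, 04, …, 45`: two matchings without a common edge correspond to two pairs
with a common element. -/
def mate : Fin 15 → Fin 6 → Fin 6 :=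
  ![![1, 0, 3, 2, 5, 4], ![5, 2, 1, 4, 3, 0], ![3, 4, 5, 0, 1, 2], ![4, 3, 5, 1, 0, 2],
    ![2, 5, 0, 4, 3, 1], ![1, 0, 4, 5, 2, 3], ![3, 5, 4, 0, 2, 1], ![4, 2, 1, 5, 0, 3],
    ![2, 3, 0, 1, 5, 4], ![5, 4, 3, 2, 1, 0], ![2, 4, 0, 5, 1, 3], ![5, 3, 4, 1, 2, 0],
    ![4, 5, 3, 2, 0, 1], ![3, 2, 1, 0, 5, 4], ![1, 0, 5, 4, 3, 2]]

/-- The labels of the joins through the point with index `a`. -/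
def star (a : Fin 6) : Finset (Fin 15) := {k | a = src k ∨ a = tgt k}

/-- The labels of the three edges of a perfect matching. -/
def labels (m : Fin 15) : Finset (Fin 15) := Finset.univ.image fun i => label i (mate m i)

theorem mem_star {a : Fin 6} {k : Fin 15} : k ∈ star a ↔ a = src k ∨ a = tgt k := by
  simp [star]

theorem mem_labels {m k : Fin 15} : k ∈ labels m ↔ ∃ i, label i (mate m i) = k := by
  simp [labels]

theorem src_ne_tgt (k : Fin 15) : src k ≠ tgt k := by revert k; decide

theorem label_src_tgt (k : Fin 15) : label (src k) (tgt k) = k := by revert k; decide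

theorem label_comm (i j : Fin 6) : label i j = label j i := by revert i j; decide

theorem src_tgt_label {i j : Fin 6} (h : i ≠ j) :
    (src (label i j) = i ∧ tgt (label i j) = j) ∨
      (src (label i j) = j ∧ tgt (label i j) = i) := by
  revert i j; decide

theorem mem_star_label {a i j : Fin 6} (h : i ≠ j) : a ∈ ({i, j} : Finset (Fin 6)) ↔
    label i j ∈ star a := by
  rcases src_tgt_label h with h | h <;> simp [mem_star, h, or_comm]

theorem eq_label_of_mem_star {a b : Fin 6} {k : Fin 15} (hab : a ≠ b) (ha : k ∈ star a)
    (hb : k ∈ star b) : k = label a b := by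
  rw [mem_star] at ha hb
  rcases ha with rfl | rfl <;> rcases hb with rfl | rfl
  · exact absurd rfl hab
  · exact (label_src_tgt k).symm
  · rw [label_comm, label_src_tgt]
  · exact absurd rfl hab

theorem mate_ne (m : Fin 15) (i : Fin 6) : mate m i ≠ i := by revert m i; decide

theorem mate_mate (m : Fin 15) (i : Fin 6) : mate m (mate m i) = i := by revert m i; decide

theorem mate_injective : Function.Injective mate := by
  have h : ∀ m n, (∀ i, mate m i = mate n i) → m = n := by decide
  exact fun m n hmn => h m n (congrFun hmn)

theorem card_star (a : Fin 6) : (star a).card = 5 := by revert a; decide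

theorem card_labels (m : Fin 15) : (labels m).card = 3 := by revert m; decide

theorem quintuples_eq : quintuples = Finset.univ.image star := by decide

theorem eq_of_mem_labels_of_mem_star {m k l : Fin 15} (hk : k ∈ labels m) (hl : l ∈ labels m)
    {a : Fin 6} (hka : k ∈ star a) (hla : l ∈ star a) : k = l := by
  have key : ∀ k ∈ labels m, k ∈ star a → k = label a (mate m a) := by
    intro k hk ha
    obtain ⟨i, rfl⟩ := mem_labels.1 hk
    rw [← mem_star_label (mate_ne m i).symm, Finset.mem_insert, Finset.mem_singleton] at ha
    rcases ha with rfl | rfl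
    · rfl
    · rw [mate_mate, label_comm]
  rw [key k hk hka, key l hl hla]

theorem exists_labels_eq {i j k : Fin 15} (hij : i ≠ j) (hik : i ≠ k) (hjk : j ≠ k)
    (h : ∀ a, ¬ (i ∈ star a ∧ j ∈ star a) ∧ ¬ (i ∈ star a ∧ k ∈ star a) ∧
      ¬ (j ∈ star a ∧ k ∈ star a)) : ∃ m, ({i, j, k} : Finset (Fin 15)) = labels m := by
  have key : ∀ i j : Fin 15, (src i ≠ src j ∧ src i ≠ tgt j ∧ tgt i ≠ src j ∧ tgt i ≠ tgt j) →
      ∀ k : Fin 15, (src i ≠ src k ∧ src i ≠ tgt k ∧ tgt i ≠ src k ∧ tgt i ≠ tgt k) →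
      (src j ≠ src k ∧ src j ≠ tgt k ∧ tgt j ≠ src k ∧ tgt j ≠ tgt k) →
      ∃ m, label (src i) (mate m (src i)) = i ∧ label (src j) (mate m (src j)) = j ∧
        label (src k) (mate m (src k)) = k := by decide +kernel
  have dis : ∀ {p q : Fin 15}, (∀ a, ¬ (p ∈ star a ∧ q ∈ star a)) →
      (src p ≠ src q ∧ src p ≠ tgt q ∧ tgt p ≠ src q ∧ tgt p ≠ tgt q) := by
    intro p q hpq
    have h1 := hpq (src p)
    have h2 := hpq (tgt p)
    simp only [mem_star, true_or, or_true, true_and, not_or] at h1 h2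
    exact ⟨h1.1, h1.2, h2.1, h2.2⟩
  obtain ⟨m, hi, hj, hk⟩ := key i j (dis fun a => (h a).1) k (dis fun a => (h a).2.1)
    (dis fun a => (h a).2.2)
  refine ⟨m, Finset.eq_of_subset_of_card_le ?_ ?_⟩
  · intro x hx
    simp only [Finset.mem_insert, Finset.mem_singleton] at hx
    rcases hx with rfl | rfl | rfl
    exacts [mem_labels.2 ⟨_, hi⟩, mem_labels.2 ⟨_, hj⟩, mem_labels.2 ⟨_, hk⟩]
  · rw [card_labels, Finset.card_eq_three.2 ⟨i, j, k, hij, hik, hjk, rfl⟩]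

/-! ### Multiplicities in the arrangement of the fifteen joins -/

/-- The joins of six points, labelled as in the matroids. -/
noncomputable def joins (P : Fin 6 → Point) (k : Fin 15) : Line := join (P (src k)) (P (tgt k))

theorem joins_label (P : Fin 6 → Point) {i j : Fin 6} (h : i ≠ j) :
    joins P (label i j) = join (P i) (P j) := by
  rcases src_tgt_label h with ⟨h1, h2⟩ | ⟨h1, h2⟩ <;> rw [joins, h1, h2]
  exact join_comm _ _

theorem concurrent_mate_iff (P : Fin 6 → Point) (m : Fin 15) :
    Concurrent P (mate m) ↔ ∃ x, ∀ k ∈ labels m, Incident x (joins P k) := by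
  refine exists_congr fun x => ⟨fun h k hk => ?_, fun h i => ?_⟩
  · obtain ⟨i, rfl⟩ := mem_labels.1 hk
    rw [joins_label P (mate_ne m i).symm]
    exact h i
  · rw [← joins_label P (mate_ne m i).symm]
    exact h _ (mem_labels.2 ⟨i, rfl⟩)

namespace Generic

variable {P : Fin 6 → Point}

theorem incident_joins_iff (hP : Generic P) (a : Fin 6) (k : Fin 15) :
    Incident (P a) (joins P k) ↔ k ∈ star a := by
  have hk := src_ne_tgt k
  constructor
  · intro h
    by_contra hne
    rw [mem_star, not_or] at hne
    exact hP.not_incident hk (Ne.symm hne.1) (Ne.symm hne.2) h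
  · intro h
    rcases mem_star.1 h with rfl | rfl
    · exact incident_join_left (hP.injective.ne hk)
    · exact incident_join_right (hP.injective.ne hk)

theorem joins_injective (hP : Generic P) : Function.Injective (joins P) := by
  intro k l hkl
  have h1 : k ∈ star (src l) := by
    rw [← hP.incident_joins_iff, hkl, hP.incident_joins_iff]; simp [mem_star]
  have h2 : k ∈ star (tgt l) := by
    rw [← hP.incident_joins_iff, hkl, hP.incident_joins_iff]; simp [mem_star]
  rw [eq_label_of_mem_star (src_ne_tgt l) h1 h2, label_src_tgt]

/-- Two joins with a common end meet only there. -/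
theorem eq_of_mem_star (hP : Generic P) {a : Fin 6} {k l : Fin 15} (hkl : k ≠ l)
    (hk : k ∈ star a) (hl : l ∈ star a) {x : Point} (hxk : Incident x (joins P k))
    (hxl : Incident x (joins P l)) : x = P a :=
  (eq_or_eq_of_incident hxk ((hP.incident_joins_iff a k).2 hk) hxl
    ((hP.incident_joins_iff a l).2 hl)).resolve_right (hP.joins_injective.ne hkl)

open Classical in
theorem multiplicity_range_joins (hP : Generic P) (x : Point) :
    multiplicity (Set.range (joins P)) x =
      (Finset.univ.filter fun k => Incident x (joins P k)).card := by
  rw [multiplicity, ← Finset.card_image_of_injective _ hP.joins_injective,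
    ← Set.ncard_coe_finset]
  congr 1
  ext l
  simp only [Set.mem_range, Set.mem_ofPred_eq, Finset.coe_image, Finset.coe_filter,
    Finset.mem_univ, true_and, Set.mem_image]
  constructor
  · rintro ⟨⟨k, rfl⟩, h⟩
    exact ⟨k, h, rfl⟩
  · rintro ⟨k, h, rfl⟩
    exact ⟨⟨k, rfl⟩, h⟩

theorem multiplicity_apply (hP : Generic P) (a : Fin 6) :
    multiplicity (Set.range (joins P)) (P a) = 5 := by
  classical
  rw [hP.multiplicity_range_joins, ← card_star a]
  congr 1
  ext k
  simp [hP.incident_joins_iff]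

/-- Outside the six points, the joins through a point have disjoint pairs of ends, so that there
are at most three of them. -/
theorem multiplicity_le_three (hP : Generic P) {x : Point} (hx : x ∉ Set.range P) :
    multiplicity (Set.range (joins P)) x ≤ 3 := by
  classical
  rw [hP.multiplicity_range_joins]
  set N := Finset.univ.filter fun k => Incident x (joins P k) with hN
  have key : ∀ k ∈ N, ∀ l ∈ N, ∀ a, k ∈ star a → l ∈ star a → k = l := by
    intro k hk l hl a hka hla
    by_contra hne
    exact hx ⟨a, (hP.eq_of_mem_star hne hka hla (Finset.mem_filter.1 hk).2
      (Finset.mem_filter.1 hl).2).symm⟩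
  have hsrc : (N.image src).card = N.card := Finset.card_image_of_injOn fun k hk l hl h =>
    key k hk l hl (src k) (by simp [mem_star]) (by simp [mem_star, h])
  have htgt : (N.image tgt).card = N.card := Finset.card_image_of_injOn fun k hk l hl h =>
    key k hk l hl (tgt k) (by simp [mem_star]) (by simp [mem_star, h])
  have hdis : Disjoint (N.image src) (N.image tgt) := by
    rw [Finset.disjoint_left]
    intro a ha hb
    obtain ⟨k, hk, rfl⟩ := Finset.mem_image.1 ha
    obtain ⟨l, hl, h⟩ := Finset.mem_image.1 hb
    have := key k hk l hl (src k) (by simp [mem_star]) (by simp [mem_star, h])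
    subst this
    exact src_ne_tgt _ h.symm
  have := Finset.card_le_univ (N.image src ∪ N.image tgt)
  rw [Finset.card_union_of_disjoint hdis, hsrc, htgt, Fintype.card_fin] at this
  omega

theorem kPoints_five (hP : Generic P) : kPoints 5 (Set.range (joins P)) = Set.range P := by
  ext x
  constructor
  · intro hx
    by_contra h
    have := hP.multiplicity_le_three h
    rw [kPoints, Set.mem_ofPred_eq] at hx
    rw [hx] at this
    omega
  · rintro ⟨a, rfl⟩
    exact hP.multiplicity_apply a

/-- The triple points of the arrangement of the joins correspond to the perfect matchings with
concurrent edges. -/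
theorem ncard_kPoints_three (hP : Generic P) :
    (kPoints 3 (Set.range (joins P))).ncard = {m | Concurrent P (mate m)}.ncard := by
  classical
  have hout : ∀ {x m}, (∀ k ∈ labels m, Incident x (joins P k)) → x ∉ Set.range P := by
    rintro x m h ⟨a, rfl⟩
    have hcard : (labels m).card ≤ 1 := Finset.card_le_one.2 fun k hk l hl =>
      eq_of_mem_labels_of_mem_star hk hl ((hP.incident_joins_iff a k).1 (h k hk))
        ((hP.incident_joins_iff a l).1 (h l hl))
    rw [card_labels] at hcard
    omega
  have hN : ∀ {x m}, (∀ k ∈ labels m, Incident x (joins P k)) →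
      (Finset.univ.filter fun k => Incident x (joins P k)) = labels m := by
    intro x m h
    refine (Finset.eq_of_subset_of_card_le (fun k hk => by simpa using h k hk) ?_).symm
    rw [card_labels, ← hP.multiplicity_range_joins]
    exact hP.multiplicity_le_three (hout h)
  choose! c hc using fun m => (concurrent_mate_iff P m).1
  symm
  refine Set.ncard_congr (fun m _ => c m) ?_ ?_ ?_
  · intro m hm
    rw [kPoints, Set.mem_ofPred_eq, hP.multiplicity_range_joins, hN (hc m hm), card_labels]
  · intro m n hm hn h
    have h1 : labels m = labels n := by
      rw [← hN (hc m hm), ← hN (hc n hn)]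
      simp only [h]
    refine mate_injective (funext fun i => ?_)
    have h2 : label i (mate m i) = label i (mate n i) :=
      eq_of_mem_labels_of_mem_star (m := m) (a := i) (mem_labels.2 ⟨i, rfl⟩)
        (h1 ▸ mem_labels.2 ⟨i, rfl⟩) ((mem_star_label (mate_ne m i).symm).1 (by simp))
        ((mem_star_label (mate_ne n i).symm).1 (by simp))
    have h3 : ∀ i j k : Fin 6, i ≠ j → i ≠ k → label i j = label i k → j = k := by decide
    exact h3 i _ _ (mate_ne m i).symm (mate_ne n i).symm h2
  · intro x hx
    rw [kPoints, Set.mem_ofPred_eq, hP.multiplicity_range_joins] at hx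
    have hxP : x ∉ Set.range P := by
      rintro ⟨a, rfl⟩
      have := hP.multiplicity_apply a
      rw [hP.multiplicity_range_joins, hx] at this
      omega
    obtain ⟨i, j, k, hij, hik, hjk, hs⟩ := Finset.card_eq_three.1 hx
    have hmem : ∀ l, l ∈ ({i, j, k} : Finset (Fin 15)) ↔ Incident x (joins P l) := by
      intro l
      rw [← hs]
      simp
    have hi := (hmem i).1 (by simp)
    have hj := (hmem j).1 (by simp)
    have hk := (hmem k).1 (by simp)
    obtain ⟨m, hm⟩ := exists_labels_eq hij hik hjk fun a =>
      ⟨fun h => hxP ⟨a, (hP.eq_of_mem_star hij h.1 h.2 hi hj).symm⟩,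
        fun h => hxP ⟨a, (hP.eq_of_mem_star hik h.1 h.2 hi hk).symm⟩,
        fun h => hxP ⟨a, (hP.eq_of_mem_star hjk h.1 h.2 hj hk).symm⟩⟩
    have hxm : ∀ l ∈ labels m, Incident x (joins P l) := fun l hl => (hmem l).1 (hm ▸ hl)
    have hcm : Concurrent P (mate m) := (concurrent_mate_iff P m).2 ⟨x, hxm⟩
    refine ⟨m, hcm, ?_⟩
    refine (eq_or_eq_of_incident (hc m hcm i (hm ▸ by simp)) hi (hc m hcm j (hm ▸ by simp))
      hj).resolve_right (hP.joins_injective.ne hij)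

end Generic

/-! ### Realizations of the matroids as joins of six points -/

section Realization

variable {NB : Finset (Finset (Fin 15))}

theorem isNonbasis_iff_mem_star (hNB : ∀ s ∈ NB, ∃ m, s = labels m) {i j k : Fin 15}
    (hij : i ≠ j) (hik : i ≠ k) (hjk : j ≠ k) {a : Fin 6} (hi : i ∈ star a) (hj : j ∈ star a) :
    IsNonbasis NB {i, j, k} ↔ k ∈ star a := by
  have hmem : ∀ {q : Finset (Fin 15)}, {i, j, k} ⊆ q → i ∈ q ∧ j ∈ q ∧ k ∈ q := fun h =>
    ⟨h (by simp), h (by simp), h (by simp)⟩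
  constructor
  · rintro ⟨-, h | ⟨q, hq, h⟩⟩
    · obtain ⟨m, hm⟩ := hNB _ h
      obtain ⟨h1, h2, -⟩ := hmem hm.subset
      exact absurd (eq_of_mem_labels_of_mem_star h1 h2 hi hj) hij
    · rw [quintuples_eq, Finset.mem_image] at hq
      obtain ⟨b, -, rfl⟩ := hq
      obtain ⟨h1, h2, h3⟩ := hmem h
      by_cases hab : a = b
      · rwa [hab]
      · exact absurd ((eq_label_of_mem_star hab hi h1).trans
          (eq_label_of_mem_star hab hj h2).symm) hij
  · intro hk
    refine ⟨Finset.card_eq_three.2 ⟨i, j, k, hij, hik, hjk, rfl⟩, Or.inr ⟨star a, ?_, ?_⟩⟩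
    · rw [quintuples_eq]
      exact Finset.mem_image_of_mem _ (Finset.mem_univ a)
    · intro x hx
      simp only [Finset.mem_insert, Finset.mem_singleton] at hx
      rcases hx with rfl | rfl | rfl <;> assumption

theorem isNonbasis_labels_iff (m : Fin 15) : IsNonbasis NB (labels m) ↔ labels m ∈ NB := by
  refine ⟨?_, fun h => ⟨card_labels m, Or.inl h⟩⟩
  rintro ⟨-, h | ⟨q, hq, h⟩⟩
  · exact h
  · rw [quintuples_eq, Finset.mem_image] at hq
    obtain ⟨b, -, rfl⟩ := hq
    have hcard : (labels m).card ≤ 1 := Finset.card_le_one.2 fun k hk l hl =>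
      eq_of_mem_labels_of_mem_star hk hl (h hk) (h hl)
    rw [card_labels] at hcard
    omega

/-- Six points in general position whose concurrent perfect matchings are the triples in `NB`
give a realization. -/
theorem Generic.isRealization_joins {P : Fin 6 → Point} (hP : Generic P)
    (hNB : ∀ s ∈ NB, ∃ m, s = labels m)
    (h : ∀ m, Concurrent P (mate m) ↔ labels m ∈ NB) : IsRealization NB (joins P) := by
  have key : ∀ i j k, i ≠ j → i ≠ k → j ≠ k → ∀ a, i ∈ star a → j ∈ star a →
      ((∃ x, Incident x (joins P i) ∧ Incident x (joins P j) ∧ Incident x (joins P k)) ↔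
        IsNonbasis NB {i, j, k}) := by
    intro i j k hij hik hjk a hi hj
    rw [isNonbasis_iff_mem_star hNB hij hik hjk hi hj, ← hP.incident_joins_iff]
    constructor
    · rintro ⟨x, h1, h2, h3⟩
      rwa [← hP.eq_of_mem_star hij hi hj h1 h2]
    · exact fun h => ⟨P a, (hP.incident_joins_iff a i).2 hi, (hP.incident_joins_iff a j).2 hj, h⟩
  intro i j k hij hik hjk
  rw [dependent_iff_concurrent]
  by_cases hdis : ∀ a, ¬ (i ∈ star a ∧ j ∈ star a) ∧ ¬ (i ∈ star a ∧ k ∈ star a) ∧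
      ¬ (j ∈ star a ∧ k ∈ star a)
  · obtain ⟨m, hm⟩ := exists_labels_eq hij hik hjk hdis
    rw [hm, isNonbasis_labels_iff, ← h, concurrent_mate_iff, ← hm]
    simp
  · push Not at hdis
    obtain ⟨a, ha⟩ := hdis
    by_cases h1 : i ∈ star a ∧ j ∈ star a
    · exact key i j k hij hik hjk a h1.1 h1.2
    by_cases h2 : i ∈ star a ∧ k ∈ star a
    · have e : ({i, j, k} : Finset (Fin 15)) = {i, k, j} := by
        rw [Finset.pair_comm]
      rw [e, ← key i k j hik hij hjk.symm a h2.1 h2.2]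
      exact exists_congr fun x => by tauto
    · have h3 : j ∈ star a ∧ k ∈ star a := by tauto
      have e : ({i, j, k} : Finset (Fin 15)) = {j, k, i} := by
        rw [Finset.insert_comm, Finset.pair_comm]
      rw [e, ← key j k i hjk hij.symm hik.symm a h3.1 h3.2]
      exact exists_congr fun x => by tauto

/-- Every realization consists of the joins of six points in general position, the points of
multiplicity five. -/
theorem IsRealization.exists_generic {L : Fin 15 → Line} (hNB : ∀ s ∈ NB, ∃ m, s = labels m)
    (hL : IsRealization NB L) :
    ∃ P, Generic P ∧ L = joins P ∧ ∀ m, Concurrent P (mate m) ↔ labels m ∈ NB := by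
  have hdep : ∀ i j k, i ≠ j → i ≠ k → j ≠ k →
      ((∃ x, Incident x (L i) ∧ Incident x (L j) ∧ Incident x (L k)) ↔
        IsNonbasis NB {i, j, k}) := fun i j k hij hik hjk => by
    rw [← dependent_iff_concurrent, hL i j k hij hik hjk]
  have hinj : Function.Injective L := by
    intro i j hij
    by_contra hne
    have htab : ∀ i j : Fin 15, i ≠ j → ∃ a k, i ≠ k ∧ j ≠ k ∧ i ∈ star a ∧
        ((j ∈ star a ∧ k ∉ star a) ∨ (k ∈ star a ∧ j ∉ star a)) := by decide +kernel
    obtain ⟨a, k, hik, hjk, hia, h⟩ := htab i j hne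
    -- the dual of the join: a common point of `L i` and `L k`
    obtain ⟨x, hi, hk⟩ := exists_line_through (L i) (L k)
    rw [incident_comm] at hi hk
    have hj : Incident x (L j) := hij ▸ hi
    rcases h with ⟨hja, hka⟩ | ⟨hka, hja⟩
    · exact hka ((isNonbasis_iff_mem_star hNB hne hik hjk hia hja).1
        ((hdep _ _ _ hne hik hjk).1 ⟨x, hi, hj, hk⟩))
    · exact hja ((isNonbasis_iff_mem_star hNB hik hne hjk.symm hia hka).1
        ((hdep _ _ _ hik hne hjk.symm).1 ⟨x, hi, hk, hj⟩))
  have hex : ∀ a, ∃ x, ∀ k, Incident x (L k) ↔ k ∈ star a := by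
    intro a
    obtain ⟨i, hi, j, hj, hij⟩ := Finset.one_lt_card.1 (by rw [card_star a]; omega)
    obtain ⟨x, hxi, hxj⟩ := exists_line_through (L i) (L j)
    rw [incident_comm] at hxi hxj
    refine ⟨x, fun k => ?_⟩
    by_cases hik : i = k
    · subst hik; simp [hxi, hi]
    by_cases hjk : j = k
    · subst hjk; simp [hxj, hj]
    rw [← isNonbasis_iff_mem_star hNB hij hik hjk hi hj, ← hdep _ _ _ hij hik hjk]
    constructor
    · exact fun h => ⟨x, hxi, hxj, h⟩
    · rintro ⟨y, hyi, hyj, hyk⟩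
      rwa [(eq_or_eq_of_incident hxi hyi hxj hyj).resolve_right (hinj.ne hij)]
  choose P hPL using hex
  have hlabel : ∀ {i j : Fin 6}, i ≠ j → Incident (P i) (L (label i j)) ∧
      Incident (P j) (L (label i j)) := fun {i j} hij => by
    rw [hPL, hPL, ← mem_star_label hij, ← mem_star_label hij]
    simp
  have hnot : ∀ {i j k : Fin 6}, i ≠ j → i ≠ k → j ≠ k → ¬ Incident (P k) (L (label i j)) :=
    fun {i j k} hij hik hjk => by
      rw [hPL, ← mem_star_label hij]
      simp [hik.symm, hjk.symm]
  have hPinj : ∀ {i j : Fin 6}, i ≠ j → P i ≠ P j := by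
    intro i j hij h
    obtain ⟨k, hik, hjk⟩ := exists_ne_ne i j
    exact hnot hik hij hjk.symm (h ▸ (hlabel hik).1)
  have hgen : Generic P := by
    intro i j k hij hik hjk l hi hj hk
    refine hnot hij hik hjk ?_
    rwa [← (eq_or_eq_of_incident hi hj (hlabel hij).1 (hlabel hij).2).resolve_left (hPinj hij)]
  have hLP : L = joins P := funext fun k =>
    eq_join (hPinj (src_ne_tgt k)) (by simp [hPL, mem_star]) (by simp [hPL, mem_star])
  refine ⟨P, hgen, hLP, fun m => ?_⟩
  obtain ⟨i, j, k, hij, hik, hjk, hs⟩ := Finset.card_eq_three.1 (card_labels m)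
  rw [← isNonbasis_labels_iff, concurrent_mate_iff, ← hLP, hs, ← hdep i j k hij hik hjk]
  simp

end Realization

/-! ### Projective frames -/

theorem Generic.bracket_ne_zero {P : Fin 6 → Point} (hP : Generic P) {w : Fin 6 → Fin 3 → ℂ}
    (hw : ∀ i, w i ≠ 0) (hPw : ∀ i, P i = Projectivization.mk ℂ (w i) (hw i)) {i j k : Fin 6}
    (hij : i ≠ j) (hik : i ≠ k) (hjk : j ≠ k) : bracket (w i) (w j) (w k) ≠ 0 := by
  intro h
  obtain ⟨l, h1, h2, h3⟩ :=
    (exists_incident_mk_iff_bracket_eq_zero (hw i) (hw j) (hw k)).2 h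
  rw [← hPw] at h1 h2 h3
  exact hP i j k hij hik hjk l h1 h2 h3

/-- To check general position it suffices to look at increasing triples of indices. -/
theorem generic_of_bracket_ne_zero {w : Fin 6 → Fin 3 → ℂ} (hw : ∀ i, w i ≠ 0)
    (h : ∀ i j k, i < j → j < k → bracket (w i) (w j) (w k) ≠ 0) :
    Generic fun i => Projectivization.mk ℂ (w i) (hw i) := by
  have key : ∀ i j k, i < j → j < k → ∀ l : Line,
      Incident (Projectivization.mk ℂ (w i) (hw i)) l →
      Incident (Projectivization.mk ℂ (w j) (hw j)) l →
      Incident (Projectivization.mk ℂ (w k) (hw k)) l → False := fun i j k hij hjk l h1 h2 h3 =>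
    h i j k hij hjk
      ((exists_incident_mk_iff_bracket_eq_zero (hw i) (hw j) (hw k)).1 ⟨l, h1, h2, h3⟩)
  intro i j k hij hik hjk l h1 h2 h3
  rcases lt_or_gt_of_ne hij with a | a <;> rcases lt_or_gt_of_ne hik with b | b <;>
    rcases lt_or_gt_of_ne hjk with c | c
  · exact key i j k a c l h1 h2 h3
  · exact key i k j b c l h1 h3 h2
  · exact absurd (a.trans c) b.asymm
  · exact key k i j b a l h3 h1 h2
  · exact key j i k a b l h2 h1 h3
  · exact absurd (c.trans a) b.asymm
  · exact key j k i c b l h2 h3 h1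
  · exact key k j i c a l h3 h2 h1

/-- The three lines of a perfect matching are concurrent exactly when the determinant of their
normals vanishes. The indices `a`, `b`, `c` represent the edges of the matching. -/
theorem Generic.concurrent_iff {P : Fin 6 → Point} (hP : Generic P) {w : Fin 6 → Fin 3 → ℂ}
    (hw : ∀ i, w i ≠ 0) (hPw : ∀ i, P i = Projectivization.mk ℂ (w i) (hw i)) {f : Fin 6 → Fin 6}
    (a b c : Fin 6) (hf : ∀ i, f i ≠ i ∧ f (f i) = i)
    (habc : ∀ i, i = a ∨ i = b ∨ i = c ∨ f i = a ∨ f i = b ∨ f i = c) :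
    Concurrent P f ↔ bracket (crossProduct (w a) (w (f a))) (crossProduct (w b) (w (f b)))
      (crossProduct (w c) (w (f c))) = 0 := by
  have hne : ∀ i, crossProduct (w i) (w (f i)) ≠ 0 := fun i h => by
    rw [← Projectivization.mk_eq_mk_iff_crossProduct_eq_zero (hw i) (hw (f i)), ← hPw, ← hPw] at h
    exact (hf i).1 (hP.injective h).symm
  have hjoin : ∀ i, join (P i) (P (f i)) =
      Projectivization.mk ℂ (crossProduct (w i) (w (f i))) (hne i) := fun i => by
    rw [join, hPw, hPw, Projectivization.cross_mk_of_cross_ne_zero]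
  rw [← exists_incident_mk_iff_bracket_eq_zero (hne a) (hne b) (hne c), ← hjoin, ← hjoin, ← hjoin]
  refine exists_congr fun x => ?_
  simp only [incident_comm (p := join _ _) (l := x)]
  constructor
  · exact fun h => ⟨h a, h b, h c⟩
  · rintro ⟨h1, h2, h3⟩ i
    have hswap : ∀ j, Incident x (join (P j) (P (f j))) → f i = j →
        Incident x (join (P i) (P (f i))) := by
      rintro _ h rfl
      rwa [(hf i).2, join_comm] at h
    rcases habc i with rfl | rfl | rfl | h | h | h
    exacts [h1, h2, h3, hswap a h1 h, hswap b h2 h, hswap c h3 h]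

/-- The vertices of the coordinate triangle and the unit point. -/
def frame : Fin 4 → Fin 3 → ℂ := ![![1, 0, 0], ![0, 1, 0], ![0, 0, 1], ![1, 1, 1]]

theorem frame_ne_zero (i : Fin 4) : frame i ≠ 0 := by
  fin_cases i <;> simp [frame]

/-- Four points, no three of which are collinear, can be moved to the standard frame. -/
theorem Generic.exists_frame {P : Fin 6 → Point} (hP : Generic P) {e : Fin 4 → Fin 6}
    (he : Function.Injective e) :
    ∃ h : (Fin 3 → ℂ) ≃ₗ[ℂ] (Fin 3 → ℂ),
      ∀ i, Unassuming.act h (P (e i)) = Projectivization.mk ℂ (frame i) (frame_ne_zero i) := by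
  set w : Fin 6 → Fin 3 → ℂ := fun i => (P i).rep with hwdef
  have hw : ∀ i, w i ≠ 0 := fun i => (P i).rep_nonzero
  have hPw : ∀ i, P i = Projectivization.mk ℂ (w i) (hw i) := fun i => (P i).mk_rep.symm
  have hbr : ∀ i j k, i ≠ j → i ≠ k → j ≠ k → bracket (w (e i)) (w (e j)) (w (e k)) ≠ 0 :=
    fun i j k hij hik hjk => hP.bracket_ne_zero hw hPw (he.ne hij) (he.ne hik) (he.ne hjk)
  obtain ⟨a, ha⟩ : ∃ a, a = w (e 0) := ⟨_, rfl⟩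
  obtain ⟨b, hb⟩ : ∃ b, b = w (e 1) := ⟨_, rfl⟩
  obtain ⟨c, hc⟩ : ∃ c, c = w (e 2) := ⟨_, rfl⟩
  obtain ⟨d, hd⟩ : ∃ d, d = w (e 3) := ⟨_, rfl⟩
  have h012 := hbr 0 1 2 (by decide) (by decide) (by decide)
  have h312 := hbr 3 1 2 (by decide) (by decide) (by decide)
  have h032 := hbr 0 3 2 (by decide) (by decide) (by decide)
  have h013 := hbr 0 1 3 (by decide) (by decide) (by decide)
  rw [← ha, ← hb, ← hc] at h012
  rw [← hd, ← hb, ← hc] at h312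
  rw [← ha, ← hd, ← hc] at h032
  rw [← ha, ← hb, ← hd] at h013
  -- the matrix with columns proportional to `a`, `b`, `c`, scaled by Cramer's rule so that the
  -- sum of the columns is proportional to `d`
  let M : Matrix (Fin 3) (Fin 3) ℂ := Matrix.of fun i =>
    ![bracket d b c * a i, bracket a d c * b i, bracket a b d * c i]
  have hM : M.det = bracket d b c * bracket a d c * bracket a b d * bracket a b c := by
    rw [Matrix.det_fin_three]
    simp [M, bracket]
    ring
  have hinj : Function.Injective M.mulVecLin := by
    rw [Matrix.coe_mulVecLin, Matrix.mulVec_injective_iff_isUnit, Matrix.isUnit_iff_isUnit_det,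
      isUnit_iff_ne_zero, hM]
    exact mul_ne_zero (mul_ne_zero (mul_ne_zero h312 h032) h013) h012
  let g := LinearEquiv.ofInjectiveEndo M.mulVecLin hinj
  have hg : ∀ v, g v = M.mulVec v := fun v => rfl
  have hgi : ∀ i, Unassuming.act g (Projectivization.mk ℂ (frame i) (frame_ne_zero i)) =
      P (e i) := by
    intro i
    rw [hPw, act_mk, Projectivization.mk_eq_mk_iff']
    fin_cases i
    · refine ⟨bracket d b c, ?_⟩
      ext t
      fin_cases t <;> simp [hg, M, frame, ← ha, Matrix.mulVec, dotProduct, Fin.sum_univ_three]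
    · refine ⟨bracket a d c, ?_⟩
      ext t
      fin_cases t <;> simp [hg, M, frame, ← hb, Matrix.mulVec, dotProduct, Fin.sum_univ_three]
    · refine ⟨bracket a b d, ?_⟩
      ext t
      fin_cases t <;> simp [hg, M, frame, ← hc, Matrix.mulVec, dotProduct, Fin.sum_univ_three]
    · refine ⟨bracket a b c, ?_⟩
      ext t
      fin_cases t <;>
        simp [hg, M, frame, ← hd, Matrix.mulVec, dotProduct, Fin.sum_univ_three, bracket] <;> ring
  exact ⟨g.symm, fun i => by rw [← hgi, act_symm_act]⟩

/-- A projective transformation fixing the standard frame is the identity. -/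
theorem act_eq_of_frame {h : (Fin 3 → ℂ) ≃ₗ[ℂ] (Fin 3 → ℂ)}
    (hh : ∀ i, act h (Projectivization.mk ℂ (frame i) (frame_ne_zero i)) =
      Projectivization.mk ℂ (frame i) (frame_ne_zero i)) (p : Point) : act h p = p := by
  have key : ∀ i, ∃ a : ℂ, a • frame i = h (frame i) := fun i => by
    have := hh i
    rwa [act_mk, Projectivization.mk_eq_mk_iff'] at this
  obtain ⟨a, ha⟩ := key 0
  obtain ⟨b, hb⟩ := key 1
  obtain ⟨c, hc⟩ := key 2
  obtain ⟨d, hd⟩ := key 3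
  have hdec : ∀ v : Fin 3 → ℂ, v = v 0 • frame 0 + v 1 • frame 1 + v 2 • frame 2 := fun v => by
    ext t
    fin_cases t <;> simp [frame]
  have hv : ∀ v : Fin 3 → ℂ, h v = ![a * v 0, b * v 1, c * v 2] := fun v => by
    conv_lhs => rw [hdec v]
    simp only [map_add, map_smul, ← ha, ← hb, ← hc]
    ext t
    fin_cases t <;> simp [frame, mul_comm]
  rw [hv] at hd
  have h0 : d = a := by simpa [frame] using congrFun hd 0
  have h1 : d = b := by simpa [frame] using congrFun hd 1
  have h2 : d = c := by simpa [frame] using congrFun hd 2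
  induction p using Projectivization.ind with | h v hv' =>
  rw [act_mk, Projectivization.mk_eq_mk_iff']
  refine ⟨d, ?_⟩
  rw [hv]
  ext t
  fin_cases t
  · simp [h0]
  · simp [h1]
  · simp [h2]

/-! ### Pappus' theorem and the classification of sets of concurrent matchings -/

/-- Pappus' theorem: two triangles in perspective in two cyclically different ways are in
perspective in the third way too. -/
theorem Generic.pappus {P : Fin 6 → Point} (hP : Generic P) (h₁ : Concurrent P (mate 0))
    (h₂ : Concurrent P (mate 1)) : Concurrent P (mate 2) := by
  obtain ⟨h, hh⟩ := hP.exists_frame (e := ![0, 2, 4, 1]) (by decide)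
  rw [← hP.concurrent_act_iff h (mate_ne _)] at h₁ h₂ ⊢
  have hQ := hP.act h
  set Q := Unassuming.act h ∘ P
  have hh' : ∀ i, Q ((![0, 2, 4, 1] : Fin 4 → Fin 6) i) =
    Projectivization.mk ℂ (frame i) (frame_ne_zero i) := hh
  obtain ⟨q, hq⟩ : ∃ q, q = (Q 3).rep := ⟨_, rfl⟩
  obtain ⟨r, hr⟩ : ∃ r, r = (Q 5).rep := ⟨_, rfl⟩
  obtain ⟨w, hwdef⟩ : ∃ w : Fin 6 → Fin 3 → ℂ,
    w = ![frame 0, frame 3, frame 1, q, frame 2, r] := ⟨_, rfl⟩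
  have hw : ∀ i, w i ≠ 0 := by
    intro i
    subst hwdef
    fin_cases i
    exacts [frame_ne_zero 0, frame_ne_zero 3, frame_ne_zero 1, hq ▸ (Q 3).rep_nonzero,
      frame_ne_zero 2, hr ▸ (Q 5).rep_nonzero]
  have hQw : ∀ i, Q i = Projectivization.mk ℂ (w i) (hw i) := by
    intro i
    subst hwdef hq hr
    fin_cases i
    exacts [hh' 0, hh' 3, hh' 1, (Q 3).mk_rep.symm, hh' 2, (Q 5).mk_rep.symm]
  rw [hQ.concurrent_iff hw hQw 0 2 4 (by decide) (by decide)] at h₁ h₂ ⊢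
  simp [bracket, hwdef, mate, frame, cross_apply] at h₁ h₂ ⊢
  grind

/-- The set of concurrent perfect matchings is closed under conjugation. -/
theorem Generic.concurrent_conj {P : Fin 6 → Point} (hP : Generic P) {m n k : Fin 15}
    (hmn : ∀ i, mate m i ≠ mate n i) (hk : ∀ i, mate k i = mate m (mate n (mate m i)))
    (hm : Concurrent P (mate m)) (hn : Concurrent P (mate n)) : Concurrent P (mate k) := by
  -- the hexagon formed by the two matchings
  let σ : Fin 15 → Fin 15 → Fin 6 → Fin 6 := fun m n =>
    ![0, mate m 0, mate n (mate m 0), mate m (mate n (mate m 0)),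
      mate n (mate m (mate n (mate m 0))), mate m (mate n (mate m (mate n (mate m 0))))]
  have hσ : ∀ m n, (∀ i, mate m i ≠ mate n i) → (∀ i j, i < j → σ m n i ≠ σ m n j) ∧
      ∀ i, σ m n (mate 0 i) = mate m (σ m n i) ∧ σ m n (mate 1 i) = mate n (σ m n i) ∧
        σ m n (mate 2 i) = mate m (mate n (mate m (σ m n i))) := by decide +kernel
  obtain ⟨h1, h2⟩ := hσ m n hmn
  have hinj : Function.Injective (σ m n) := fun i j hij => by
    rcases lt_trichotomy i j with h | h | h
    · exact absurd hij (h1 i j h)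
    · exact h
    · exact absurd hij.symm (h1 j i h)
  rw [← concurrent_comp_iff P hinj fun i => (h2 i).1] at hm
  rw [← concurrent_comp_iff P hinj fun i => (h2 i).2.1] at hn
  rw [← concurrent_comp_iff P hinj fun i => (h2 i).2.2.trans (hk _).symm]
  exact (hP.comp hinj).pappus hm hn

/-- The matchings that are concurrent in a realization of the first matroid. -/
def conc₁ (m : Fin 15) : Bool := m ∈ ({2, 4, 5, 11, 12, 13} : Finset (Fin 15))

/-- The matchings that are concurrent in a realization of the second matroid. -/
def conc₂ (m : Fin 15) : Bool := m ∈ ({0, 1, 2, 9, 13, 14} : Finset (Fin 15))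

theorem conc₁_iff (m : Fin 15) : conc₁ m = true ↔ labels m ∈ NB₁ := by
  revert m; decide +kernel

theorem conc₂_iff (m : Fin 15) : conc₂ m = true ↔ labels m ∈ NB₂ := by
  revert m; decide +kernel

theorem exists_labels_of_mem_NB₁ : ∀ s ∈ NB₁, ∃ m, s = labels m := by
  simp only [NB₁, Finset.mem_insert, Finset.mem_singleton, forall_eq_or_imp, forall_eq]
  exact ⟨⟨5, by decide⟩, ⟨4, by decide⟩, ⟨12, by decide⟩, ⟨11, by decide⟩, ⟨13, by decide⟩,
    ⟨2, by decide⟩⟩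

theorem exists_labels_of_mem_NB₂ : ∀ s ∈ NB₂, ∃ m, s = labels m := by
  simp only [NB₂, Finset.mem_insert, Finset.mem_singleton, forall_eq_or_imp, forall_eq]
  exact ⟨⟨0, by decide⟩, ⟨14, by decide⟩, ⟨9, by decide⟩, ⟨1, by decide⟩, ⟨13, by decide⟩,
    ⟨2, by decide⟩⟩

/-- Permutations of the six points giving all the conjugates of `conc₁`. -/
def relabel₁ : Fin 15 → Fin 6 → Fin 6 :=
  ![![0, 1, 2, 3, 4, 5], ![0, 1, 2, 3, 5, 4], ![0, 1, 2, 4, 3, 5], ![0, 1, 2, 4, 5, 3],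
    ![0, 1, 2, 5, 3, 4], ![0, 1, 2, 5, 4, 3], ![0, 1, 3, 2, 4, 5], ![0, 1, 3, 2, 5, 4],
    ![0, 1, 3, 4, 5, 2], ![0, 1, 3, 5, 4, 2], ![0, 1, 4, 2, 5, 3], ![0, 1, 4, 3, 5, 2],
    ![0, 2, 3, 1, 4, 5], ![0, 2, 3, 1, 5, 4], ![0, 2, 4, 1, 5, 3]]

/-- Permutations of the six points giving all the conjugates of `conc₂`. -/
def relabel₂ : Fin 10 → Fin 6 → Fin 6 :=
  ![![0, 1, 2, 3, 4, 5], ![0, 1, 2, 3, 5, 4], ![0, 1, 2, 4, 3, 5], ![0, 1, 3, 2, 4, 5],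
    ![0, 1, 3, 2, 5, 4], ![0, 1, 4, 2, 5, 3], ![0, 2, 1, 3, 4, 5], ![0, 2, 1, 3, 5, 4],
    ![0, 2, 1, 4, 3, 5], ![0, 3, 1, 4, 2, 5]]

/-- Not exactly two of three propositions are true. -/
def NotTwo (a b c : Bool) : Prop := (a && b) = (a && c) ∧ (a && b) = (b && c)

instance (a b c : Bool) : Decidable (NotTwo a b c) := inferInstanceAs (Decidable (_ ∧ _))

set_option synthInstance.maxSize 2000 in
set_option synthInstance.maxHeartbeats 400000 in
/-- A transitive relation on six elements (given by fifteen pairs) with exactly six pairs is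
either complete on four elements or consists of two triangles. In terms of matchings, it is
conjugate to `conc₁` or to `conc₂`. The pairs are decided element by element, so that the
intransitive ones are discarded early. -/
theorem classification :
    ∀ c01 : Bool,
    ∀ c02 c12 : Bool,
    NotTwo c01 c02 c12 →
    ∀ c03 c13 c23 : Bool,
    NotTwo c01 c03 c13 →
    NotTwo c02 c03 c23 →
    NotTwo c12 c13 c23 →
    ∀ c04 c14 c24 c34 : Bool,
    NotTwo c01 c04 c14 →
    NotTwo c02 c04 c24 →
    NotTwo c03 c04 c34 →
    NotTwo c12 c14 c24 →
    NotTwo c13 c14 c34 →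
    NotTwo c23 c24 c34 →
    ∀ c05 c15 c25 c35 c45 : Bool,
    NotTwo c01 c05 c15 →
    NotTwo c02 c05 c25 →
    NotTwo c03 c05 c35 →
    NotTwo c04 c05 c45 →
    NotTwo c12 c15 c25 →
    NotTwo c13 c15 c35 →
    NotTwo c14 c15 c45 →
    NotTwo c23 c25 c35 →
    NotTwo c24 c25 c45 →
    NotTwo c34 c35 c45 →
    c01.toNat + c02.toNat + c12.toNat + c03.toNat + c13.toNat + c23.toNat +
      c04.toNat + c14.toNat + c24.toNat + c34.toNat +
      c05.toNat + c15.toNat + c25.toNat + c35.toNat + c45.toNat = 6 →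
    (∃ t, ∀ m, ∃ m', (∀ i, relabel₁ t (mate m i) = mate m' (relabel₁ t i)) ∧
      (![c01, c02, c12, c03, c13, c23, c04, c14, c24, c34, c05, c15, c25, c35, c45] :
        Fin 15 → Bool) m' = conc₁ m) ∨
     (∃ t, ∀ m, ∃ m', (∀ i, relabel₂ t (mate m i) = mate m' (relabel₂ t i)) ∧
      (![c01, c02, c12, c03, c13, c23, c04, c14, c24, c34, c05, c15, c25, c35, c45] :
        Fin 15 → Bool) m' = conc₂ m) := by
  decide +kernel

/-- If exactly six perfect matchings of six points in general position are concurrent, then the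
points can be relabelled so that these are the triples of one of the two matroids. -/
theorem Generic.exists_relabelling {P : Fin 6 → Point} (hP : Generic P)
    (hcard : {m | Concurrent P (mate m)}.ncard = 6) :
    ∃ σ : Fin 6 → Fin 6, Function.Injective σ ∧
      ((∀ m, Concurrent (P ∘ σ) (mate m) ↔ labels m ∈ NB₁) ∨
        (∀ m, Concurrent (P ∘ σ) (mate m) ↔ labels m ∈ NB₂)) := by
  classical
  obtain ⟨c, hc⟩ : ∃ c : Fin 15 → Bool, ∀ m, c m = true ↔ Concurrent P (mate m) :=
    ⟨fun m => decide (Concurrent P (mate m)), fun m => decide_eq_true_iff⟩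
  have h2 : ∀ m n k, ((∀ i, mate m i ≠ mate n i) ∧ (∀ i, mate m i ≠ mate k i) ∧
      (∀ i, mate n i ≠ mate k i)) ∧ ((∀ i, mate k i = mate m (mate n (mate m i))) ∧
      (∀ i, mate n i = mate m (mate k (mate m i))) ∧
      (∀ i, mate m i = mate n (mate k (mate n i)))) → NotTwo (c m) (c n) (c k) := by
    rintro m n k ⟨⟨hmn, hmk, hnk⟩, h1, h2, h3⟩
    have e1 := hP.concurrent_conj hmn h1
    have e2 := hP.concurrent_conj hmk h2
    have e3 := hP.concurrent_conj hnk h3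
    rw [← hc, ← hc, ← hc] at e1 e2 e3
    revert e1 e2 e3
    generalize c m = x
    generalize c n = y
    generalize c k = z
    revert x y z
    decide
  have hsum : ∑ m, (c m).toNat = 6 := by
    have : {m | Concurrent P (mate m)} = ((Finset.univ.filter fun m => c m = true : Finset _) :
      Set (Fin 15)) := by ext m; simp [hc]
    rw [this, Set.ncard_coe_finset, Finset.card_filter] at hcard
    rw [← hcard]
    exact Finset.sum_congr rfl fun m _ => by cases c m <;> rfl
  simp only [Fin.sum_univ_succ, Fin.sum_univ_zero] at hsum
  have hvec : ![c 0, c 1, c 2, c 3, c 4, c 5, c 6, c 7, c 8, c 9, c 10, c 11, c 12, c 13, c 14] = c := by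
    ext m
    fin_cases m <;> rfl
  have h := classification
    (c 0)
    (c 1) (c 2)
    (h2 0 1 2 (by decide))
    (c 3) (c 4) (c 5)
    (h2 0 3 4 (by decide))
    (h2 1 3 5 (by decide))
    (h2 2 4 5 (by decide))
    (c 6) (c 7) (c 8) (c 9)
    (h2 0 6 7 (by decide))
    (h2 1 6 8 (by decide))
    (h2 3 6 9 (by decide))
    (h2 2 7 8 (by decide))
    (h2 4 7 9 (by decide))
    (h2 5 8 9 (by decide))
    (c 10) (c 11) (c 12) (c 13) (c 14)
    (h2 0 10 11 (by decide))
    (h2 1 10 12 (by decide))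
    (h2 3 10 13 (by decide))
    (h2 6 10 14 (by decide))
    (h2 2 11 12 (by decide))
    (h2 4 11 13 (by decide))
    (h2 7 11 14 (by decide))
    (h2 5 12 13 (by decide))
    (h2 8 12 14 (by decide))
    (h2 9 13 14 (by decide))
    (by rw [← hsum]; simp [add_assoc])
  rw [hvec] at h
  rcases h with ⟨t, ht⟩ | ⟨t, ht⟩
  · have hinj : Function.Injective (relabel₁ t) := by
      have : ∀ t i j, relabel₁ t i = relabel₁ t j → i = j := by decide +kernel
      exact fun i j => this t i j
    refine ⟨relabel₁ t, hinj, Or.inl fun m => ?_⟩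
    obtain ⟨m', h1, h2⟩ := ht m
    rw [concurrent_comp_iff P hinj h1, ← hc, h2, conc₁_iff]
  · have hinj : Function.Injective (relabel₂ t) := by
      have : ∀ t i j, relabel₂ t i = relabel₂ t j → i = j := by decide +kernel
      exact fun i j => this t i j
    refine ⟨relabel₂ t, hinj, Or.inr fun m => ?_⟩
    obtain ⟨m', h1, h2⟩ := ht m
    rw [concurrent_comp_iff P hinj h1, ← hc, h2, conc₂_iff]

/-! ### The normal form of six points -/

/-- The standard frame followed by two points off the line at infinity. -/
def normalForm (a b c d : ℂ) : Fin 6 → Fin 3 → ℂ :=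
  ![![1, 0, 0], ![0, 1, 0], ![0, 0, 1], ![1, 1, 1], ![a, b, 1], ![c, d, 1]]

theorem normalForm_ne_zero (a b c d : ℂ) (i : Fin 6) : normalForm a b c d i ≠ 0 := by
  fin_cases i <;> simp [normalForm]

theorem exists_affine_coordinates (p : Point) (h : ∀ l : Line,
    Incident (Projectivization.mk ℂ (frame 0) (frame_ne_zero 0)) l →
    Incident (Projectivization.mk ℂ (frame 1) (frame_ne_zero 1)) l → ¬ Incident p l) :
    ∃ a b : ℂ, p = Projectivization.mk ℂ ![a, b, 1] (by simp) := by
  induction p using Projectivization.ind with | h v hv =>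
  have h2 : v 2 ≠ 0 := by
    intro h2
    obtain ⟨l, h0, h1, hl⟩ := (exists_incident_mk_iff_bracket_eq_zero (frame_ne_zero 0)
      (frame_ne_zero 1) hv).2 (by simp [bracket, frame, h2])
    exact h l h0 h1 hl
  refine ⟨v 0 / v 2, v 1 / v 2, ?_⟩
  rw [Projectivization.mk_eq_mk_iff']
  refine ⟨v 2, ?_⟩
  ext t
  fin_cases t <;> simp [mul_div_cancel₀ _ h2]

theorem Generic.exists_normalForm {P : Fin 6 → Point} (hP : Generic P) :
    ∃ (h : (Fin 3 → ℂ) ≃ₗ[ℂ] (Fin 3 → ℂ)) (a b c d : ℂ), ∀ i, Unassuming.act h (P i) =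
      Projectivization.mk ℂ (normalForm a b c d i) (normalForm_ne_zero a b c d i) := by
  obtain ⟨h, hh⟩ := hP.exists_frame (e := ![0, 1, 2, 3]) (by decide)
  have hQ := hP.act h
  have haff : ∀ i, i ≠ 0 → i ≠ 1 → ∃ a b : ℂ, Unassuming.act h (P i) =
      Projectivization.mk ℂ ![a, b, 1] (by simp) := fun i h0 h1 => by
    refine exists_affine_coordinates _ ?_
    rw [← hh 0, ← hh 1]
    exact hQ 0 1 i (by decide) h0.symm h1.symm
  obtain ⟨a, b, hab⟩ := haff 4 (by decide) (by decide)
  obtain ⟨c, d, hcd⟩ := haff 5 (by decide) (by decide)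
  refine ⟨h, a, b, c, d, fun i => ?_⟩
  fin_cases i
  exacts [hh 0, hh 1, hh 2, hh 3, hab, hcd]

/-! ### The family -/

theorem sqrt_five_sq : ((√5 : ℝ) : ℂ) ^ 2 = 5 := by
  rw [← Complex.ofReal_pow, Real.sq_sqrt (by norm_num)]
  norm_num

/-- Six points with the concurrent matchings of the first matroid form an arrangement of the
family. -/
theorem Generic.inB6 {P : Fin 6 → Point} (hP : Generic P)
    (hc : ∀ m, Concurrent P (mate m) ↔ conc₁ m = true) : InB6 (Set.range P) := by
  have he : Function.Injective (![2, 4, 1, 5, 0, 3] : Fin 6 → Fin 6) := by decide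
  obtain ⟨h, a, b, c, d, hh⟩ := (hP.comp he).exists_normalForm
  have hQ := (hP.comp he).act h
  have hrange : Set.range (P ∘ (![2, 4, 1, 5, 0, 3] : Fin 6 → Fin 6)) = Set.range P :=
    (Finite.injective_iff_surjective.mp he).range_comp P
  have hconc : ∀ (m : Fin 15) (f : Fin 6 → Fin 6) (x y z : Fin 6), (∀ i, f i ≠ i ∧ f (f i) = i) →
      (∀ i, i = x ∨ i = y ∨ i = z ∨ f i = x ∨ f i = y ∨ f i = z) →
      (∀ i, (![2, 4, 1, 5, 0, 3] : Fin 6 → Fin 6) (f i) =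
        mate m ((![2, 4, 1, 5, 0, 3] : Fin 6 → Fin 6) i)) →
      (bracket (crossProduct (normalForm a b c d x) (normalForm a b c d (f x)))
        (crossProduct (normalForm a b c d y) (normalForm a b c d (f y)))
        (crossProduct (normalForm a b c d z) (normalForm a b c d (f z))) = 0 ↔
          conc₁ m = true) := by
    intro m f x y z hf hxyz hm
    rw [← hQ.concurrent_iff (normalForm_ne_zero a b c d) hh x y z hf hxyz,
      (hP.comp he).concurrent_act_iff h (fun i => (hf i).1), concurrent_comp_iff P he hm, hc]
  have h13 := (hconc 13 ![2, 3, 0, 1, 5, 4] 0 1 4 (by decide) (by decide) (by decide)).2 (by decide)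
  have h2 := (hconc 2 ![3, 2, 1, 0, 5, 4] 0 1 4 (by decide) (by decide) (by decide)).2 (by decide)
  have h4 := (hconc 4 ![4, 5, 3, 2, 0, 1] 0 1 2 (by decide) (by decide) (by decide)).2 (by decide)
  have h12 := (hconc 12 ![5, 4, 3, 2, 1, 0] 0 1 2 (by decide) (by decide) (by decide)).2 (by decide)
  have h7 := (hconc 7 ![2, 4, 0, 5, 1, 3] 0 1 3 (by decide) (by decide) (by decide)).not.2
    (by decide)
  have h1 := (hconc 1 ![2, 5, 0, 4, 3, 1] 0 1 3 (by decide) (by decide) (by decide)).not.2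
    (by decide)
  have ha := hQ.bracket_ne_zero (normalForm_ne_zero a b c d) hh (i := 1) (j := 2) (k := 4)
    (by decide) (by decide) (by decide)
  have hb := hQ.bracket_ne_zero (normalForm_ne_zero a b c d) hh (i := 0) (j := 2) (k := 4)
    (by decide) (by decide) (by decide)
  have hab := hQ.bracket_ne_zero (normalForm_ne_zero a b c d) hh (i := 2) (j := 4) (k := 5)
    (by decide) (by decide) (by decide)
  simp [bracket, normalForm, cross_apply] at h13 h2 h4 h12 h7 h1 ha hb hab
  clear hconc hc hQ
  have hc' : c = b := by grind
  have hd' : d = a := by grind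
  subst hc' hd'
  have hsub : d - c ≠ 0 := by grind
  have hadd : d + c = 1 := by
    refine mul_left_cancel₀ hsub ?_
    grind
  refine ⟨d - c, ?_, h, ?_⟩
  · have h5 := sqrt_five_sq
    simp only [excluded, Set.mem_insert_iff, Set.mem_singleton_iff, not_or]
    generalize ((√5 : ℝ) : ℂ) = s at h5 ⊢
    clear hh
    refine ⟨?_, ?_, ?_, ?_, ?_, ?_, ?_⟩ <;> intro hz <;> grind
  · rw [← hrange, ← Set.range_comp]
    congr 1
    ext1 i
    rw [Function.comp_apply, hh, familyLine, Projectivization.mk_eq_mk_iff']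
    have hd : d = 1 - c := by linear_combination hadd
    subst hd
    fin_cases i
    · exact ⟨1, by simp [normalForm, familyNormal]⟩
    · exact ⟨1, by simp [normalForm, familyNormal]⟩
    · exact ⟨1, by simp [normalForm, familyNormal]⟩
    · exact ⟨1, by simp [normalForm, familyNormal]⟩
    all_goals
      refine ⟨2⁻¹, ?_⟩
      ext t
      fin_cases t <;> simp [normalForm, familyNormal] <;> ring

theorem eq_of_labelledEquiv_familyLine {z z' : ℂ}
    (h : LabelledEquiv (familyLine z) (familyLine z')) : z = z' := by
  obtain ⟨h, hh⟩ := h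
  have hframe : ∀ i, act h (Projectivization.mk ℂ (frame i) (frame_ne_zero i)) =
      Projectivization.mk ℂ (frame i) (frame_ne_zero i) := by
    intro i
    fin_cases i
    exacts [hh 0, hh 1, hh 2, hh 3]
  have h4 := hh 4
  rw [act_eq_of_frame hframe, familyLine, familyLine, Projectivization.mk_eq_mk_iff'] at h4
  obtain ⟨a, ha⟩ := h4
  have h2 := congrFun ha 2
  have h0 := congrFun ha 0
  simp [familyNormal] at h0 h2
  subst h2
  linear_combination -h0

/-! ### The Hesse configuration -/

/-- Six of the twelve points dual to the Hesse arrangement: the vertices of the coordinate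
triangle, in the even places, and the points `(1, 1, 1)`, `(ω, ω², 1)`, `(ω², ω, 1)`. -/
def hesseNormal (ω : ℂ) : Fin 6 → Fin 3 → ℂ :=
  ![![1, 0, 0], ![1, 1, 1], ![0, 1, 0], ![ω, ω ^ 2, 1], ![0, 0, 1], ![ω ^ 2, ω, 1]]

theorem hesseNormal_ne_zero (ω : ℂ) (i : Fin 6) : hesseNormal ω i ≠ 0 := by
  fin_cases i <;> simp [hesseNormal]

/-- The points with coordinates `hesseNormal`. -/
noncomputable def hessePoint (ω : ℂ) (i : Fin 6) : Point :=
  Projectivization.mk ℂ (hesseNormal ω i) (hesseNormal_ne_zero ω i)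

theorem generic_hessePoint {ω : ℂ} (hω : ω ^ 2 + ω + 1 = 0) : Generic (hessePoint ω) := by
  refine generic_of_bracket_ne_zero (hesseNormal_ne_zero ω) fun i j k hij hjk h => ?_
  fin_cases i <;> fin_cases j <;> first | exact absurd hij (by decide) | skip
  all_goals fin_cases k <;> first | exact absurd hjk (by decide) | skip
  all_goals
    simp [bracket, hesseNormal] at h
    try grind

theorem concurrent_hessePoint_iff {ω : ℂ} (hω : ω ^ 2 + ω + 1 = 0) (m : Fin 15) :
    Concurrent (hessePoint ω) (mate m) ↔ conc₂ m = true := by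
  -- representatives of the edges of a matching, the first of which contains `0`
  let b : Fin 15 → Fin 6 := fun m => if mate m 0 = 1 then 2 else 1
  let c : Fin 15 → Fin 6 := ![4, 3, 2, 2, 3, 3, 2, 3, 4, 2, 3, 2, 2, 4, 3]
  have hbc : ∀ m i, i = 0 ∨ i = b m ∨ i = c m ∨ mate m i = 0 ∨ mate m i = b m ∨
    mate m i = c m := by decide
  rw [(generic_hessePoint hω).concurrent_iff (hesseNormal_ne_zero ω) (fun i => rfl) 0 (b m) (c m)
    (fun i => ⟨mate_ne m i, mate_mate m i⟩) (hbc m)]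
  fin_cases m
  all_goals
    simp [bracket, hesseNormal, cross_apply, b, c, mate, conc₂]
    try grind

/-- Six points with the concurrent matchings of the second matroid form a Hesse configuration. -/
theorem Generic.exists_hessePoint {P : Fin 6 → Point} (hP : Generic P)
    (hc : ∀ m, Concurrent P (mate m) ↔ conc₂ m = true) :
    ∃ ω : ℂ, ω ^ 2 + ω + 1 = 0 ∧ ∃ h : (Fin 3 → ℂ) ≃ₗ[ℂ] (Fin 3 → ℂ),
      ∀ i, Unassuming.act h (P i) = hessePoint ω i := by
  have he : Function.Injective (![0, 2, 4, 1, 3, 5] : Fin 6 → Fin 6) := by decide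
  obtain ⟨h, a, b, c, d, hh⟩ := (hP.comp he).exists_normalForm
  have hQ := (hP.comp he).act h
  have hconc : ∀ (m : Fin 15) (f : Fin 6 → Fin 6), (∀ i, f i ≠ i ∧ f (f i) = i) →
      (∀ i, i = 0 ∨ i = 1 ∨ i = 2 ∨ f i = 0 ∨ f i = 1 ∨ f i = 2) →
      (∀ i, (![0, 2, 4, 1, 3, 5] : Fin 6 → Fin 6) (f i) =
        mate m ((![0, 2, 4, 1, 3, 5] : Fin 6 → Fin 6) i)) → conc₂ m = true →
      bracket (crossProduct (normalForm a b c d 0) (normalForm a b c d (f 0)))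
        (crossProduct (normalForm a b c d 1) (normalForm a b c d (f 1)))
        (crossProduct (normalForm a b c d 2) (normalForm a b c d (f 2))) = 0 := by
    intro m f hf hxyz hm hcm
    rwa [← hQ.concurrent_iff (normalForm_ne_zero a b c d) hh 0 1 2 hf hxyz,
      (hP.comp he).concurrent_act_iff h (fun i => (hf i).1), concurrent_comp_iff P he hm, hc]
  have h0 := hconc 0 ![3, 4, 5, 0, 1, 2] (by decide) (by decide) (by decide) (by decide)
  have h9 := hconc 9 ![5, 4, 3, 2, 1, 0] (by decide) (by decide) (by decide) (by decide)
  have h13 := hconc 13 ![4, 3, 5, 1, 0, 2] (by decide) (by decide) (by decide) (by decide)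
  have h2 := hconc 2 ![4, 5, 3, 2, 0, 1] (by decide) (by decide) (by decide) (by decide)
  have ha := hQ.bracket_ne_zero (normalForm_ne_zero a b c d) hh (i := 1) (j := 2) (k := 4)
    (by decide) (by decide) (by decide)
  have ha1 := hQ.bracket_ne_zero (normalForm_ne_zero a b c d) hh (i := 1) (j := 3) (k := 4)
    (by decide) (by decide) (by decide)
  simp [bracket, normalForm, cross_apply] at h0 h9 h13 h2 ha ha1
  clear hconc hc hQ
  have hca : c = b := by grind
  have hb : b = a ^ 2 := by grind
  have hd : d = a := by grind
  have hω : a ^ 2 + a + 1 = 0 := by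
    have ha1' : a - 1 ≠ 0 := by grind
    refine mul_left_cancel₀ (mul_ne_zero ha ha1') ?_
    grind
  refine ⟨a, hω, h, fun i => ?_⟩
  subst hca hd
  obtain ⟨k, rfl⟩ := Finite.injective_iff_surjective.mp he i
  have hk := hh k
  rw [Function.comp_apply] at hk
  rw [hk, hessePoint, Projectivization.mk_eq_mk_iff']
  refine ⟨1, ?_⟩
  fin_cases k <;> simp [normalForm, hesseNormal, hb]

theorem eq_or_eq_sq_of_root {j ω : ℂ} (hj : j ^ 2 + j + 1 = 0) (hω : ω ^ 2 + ω + 1 = 0) :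
    ω = j ∨ ω = j ^ 2 := by
  rw [← sub_eq_zero, ← sub_eq_zero (b := j ^ 2), ← mul_eq_zero]
  grind

theorem range_hessePoint_sq {j : ℂ} (hj : j ^ 2 + j + 1 = 0) :
    Set.range (hessePoint (j ^ 2)) = Set.range (hessePoint j) := by
  have h4 : (j ^ 2) ^ 2 = j := by grind
  have he : Function.Surjective (![0, 1, 2, 5, 4, 3] : Fin 6 → Fin 6) := by decide
  rw [← he.range_comp (hessePoint j)]
  congr 1
  ext1 i
  rw [Function.comp_apply, hessePoint, hessePoint, Projectivization.mk_eq_mk_iff']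
  refine ⟨1, ?_⟩
  fin_cases i <;> simp [hesseNormal, h4]

theorem hessePoint_injective {ω ω' : ℂ} {h : (Fin 3 → ℂ) ≃ₗ[ℂ] (Fin 3 → ℂ)}
    (hh : ∀ i, act h (hessePoint ω i) = hessePoint ω' i) : ω = ω' := by
  have hframe : ∀ i, act h (Projectivization.mk ℂ (frame i) (frame_ne_zero i)) =
      Projectivization.mk ℂ (frame i) (frame_ne_zero i) := by
    intro i
    fin_cases i
    exacts [hh 0, hh 2, hh 4, hh 1]
  have h3 := hh 3
  rw [act_eq_of_frame hframe, hessePoint, hessePoint, Projectivization.mk_eq_mk_iff'] at h3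
  obtain ⟨a, ha⟩ := h3
  have h2 := congrFun ha 2
  have h0 := congrFun ha 0
  simp [hesseNormal] at h0 h2
  subst h2
  linear_combination -h0

/-! ### Projective equivalence -/

theorem ProjEquiv.symm {A B : Set Line} (h : ProjEquiv A B) : ProjEquiv B A := by
  obtain ⟨h, rfl⟩ := h
  refine ⟨h.symm, ?_⟩
  rw [← Set.image_comp]
  simp [act_symm_act]

theorem ProjEquiv.trans {A B C : Set Line} (h : ProjEquiv A B) (h' : ProjEquiv B C) :
    ProjEquiv A C := by
  obtain ⟨h, rfl⟩ := h
  obtain ⟨g, rfl⟩ := h'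
  refine ⟨h.trans g, ?_⟩
  rw [← Set.image_comp]
  simp only [Function.comp_def, act_trans]

/-- Projectively equivalent sextuples of points have equivalent labelled arrangements of joins. -/
theorem Generic.labelledEquiv_joins {P Q : Fin 6 → Point} (hP : Generic P)
    {h : (Fin 3 → ℂ) ≃ₗ[ℂ] (Fin 3 → ℂ)} (hh : ∀ i, Unassuming.act h (P i) = Q i) :
    LabelledEquiv (joins P) (joins Q) := by
  obtain ⟨g, hg⟩ := exists_act_incident h
  refine ⟨g, fun k => ?_⟩
  rw [joins, act_join hg (hP.injective.ne (src_ne_tgt k)), hh, hh, joins]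

/-- A labelled equivalence between the arrangements of joins is induced by an equivalence of the
sextuples of points. -/
theorem Generic.exists_act_eq {P Q : Fin 6 → Point} (hP : Generic P) (hQ : Generic Q)
    (h : LabelledEquiv (joins P) (joins Q)) :
    ∃ g : (Fin 3 → ℂ) ≃ₗ[ℂ] (Fin 3 → ℂ), ∀ i, Unassuming.act g (P i) = Q i := by
  obtain ⟨h, hh⟩ := h
  obtain ⟨g, hg⟩ := exists_contragredient h
  refine ⟨g, fun a => ?_⟩
  obtain ⟨k, hk, l, hl, hkl⟩ := Finset.one_lt_card.1 (by rw [card_star a]; omega)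
  refine hQ.eq_of_mem_star hkl hk hl ?_ ?_
  · rw [← hh, hg, hP.incident_joins_iff]
    exact hk
  · rw [← hh, hg, hP.incident_joins_iff]
    exact hl

/-- The arrangements in a moduli space are the sextuples of points with the prescribed concurrent
matchings. -/
theorem inModuli_iff {NB : Finset (Finset (Fin 15))} (hNB : ∀ s ∈ NB, ∃ m, s = labels m)
    (C : Set Line) : InModuli NB C ↔ ∃ P : Fin 6 → Point, Generic P ∧
      (∀ m, Concurrent P (mate m) ↔ labels m ∈ NB) ∧ C = Set.range P := by
  constructor
  · rintro ⟨L, hL, rfl⟩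
    obtain ⟨P, hP, rfl, hc⟩ := hL.exists_generic hNB
    exact ⟨P, hP, hc, hP.kPoints_five⟩
  · rintro ⟨P, hP, hc, rfl⟩
    exact ⟨joins P, hP.isRealization_joins hNB hc, hP.kPoints_five.symm⟩

/-! ### Unassuming arrangements as sextuples of points -/

theorem IsUnassuming.exists_generic {C : Set Line} (hC : IsUnassuming C) :
    ∃ P : Fin 6 → Point, Generic P ∧ C = Set.range P := by
  have hfin : C.Finite := Set.finite_of_ncard_ne_zero (by rw [hC.card_lines]; omega)
  have hcard : hfin.toFinset.card = 6 := by
    rw [← Set.ncard_eq_toFinset_card C hfin, hC.card_lines]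
  let e := (hfin.toFinset.equivFinOfCardEq hcard).symm
  have hinj : Function.Injective fun i => (e i : Line) :=
    Subtype.val_injective.comp e.injective
  have hmem : ∀ i, (e i : Line) ∈ C := fun i => hfin.mem_toFinset.1 (e i).2
  refine ⟨fun i => (e i : Line), ?_, ?_⟩
  · intro i j k hij hik hjk x hi hj hk
    have hsub : ({(e i : Line), (e j : Line), (e k : Line)} : Set Line) ⊆
        {l | l ∈ C ∧ Incident x l} := by
      rintro l (rfl | rfl | rfl)
      exacts [⟨hmem i, incident_comm.1 hi⟩, ⟨hmem j, incident_comm.1 hj⟩,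
        ⟨hmem k, incident_comm.1 hk⟩]
    have h3 : ({(e i : Line), (e j : Line), (e k : Line)} : Set Line).ncard = 3 :=
      Set.ncard_eq_three.2 ⟨_, _, _, hinj.ne hij, hinj.ne hik, hinj.ne hjk, rfl⟩
    have hle : 3 ≤ multiplicity C x := by
      rw [← h3]
      exact Set.ncard_le_ncard hsub (hfin.subset fun l hl => hl.1)
    have := hC.singularities x (by omega)
    omega
  · ext l
    constructor
    · intro hl
      exact ⟨e.symm ⟨l, hfin.mem_toFinset.2 hl⟩, by simp⟩
    · rintro ⟨i, rfl⟩
      exact hmem i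

theorem Generic.check_range {P : Fin 6 → Point} (hP : Generic P) :
    check (Set.range P) = Set.range (joins P) := by
  ext l
  have hfin : {p | p ∈ dualPoints (Set.range P) ∧ Incident p l}.Finite :=
    (Set.finite_range P).subset fun p hp => hp.1
  have hiff : l ∈ check (Set.range P) ↔
      ∃ p q, p ∈ {p | p ∈ dualPoints (Set.range P) ∧ Incident p l} ∧
        q ∈ {p | p ∈ dualPoints (Set.range P) ∧ Incident p l} ∧ p ≠ q :=
    Set.one_lt_ncard_iff hfin
  rw [hiff]
  constructor
  · rintro ⟨_, _, ⟨⟨i, rfl⟩, hi⟩, ⟨⟨j, rfl⟩, hj⟩, hij⟩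
    refine ⟨label i j, ?_⟩
    rw [joins_label P fun h => hij (congrArg P h)]
    exact (eq_join hij hi hj).symm
  · rintro ⟨k, rfl⟩
    have hne := hP.injective.ne (src_ne_tgt k)
    exact ⟨_, _, ⟨⟨src k, rfl⟩, incident_join_left hne⟩, ⟨⟨tgt k, rfl⟩, incident_join_right hne⟩,
      hne⟩

theorem IsUnassuming.inB6_or_inModuli {C : Set Line} (hC : IsUnassuming C) :
    (InB6 C ∧ InModuli NB₁ C) ∨ InModuli NB₂ C := by
  obtain ⟨P, hP, rfl⟩ := hC.exists_generic
  have hcard := hC.check_t_three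
  rw [t, hP.check_range, hP.ncard_kPoints_three] at hcard
  obtain ⟨σ, hσ, h⟩ := hP.exists_relabelling hcard
  have hrange : Set.range (P ∘ σ) = Set.range P :=
    (Finite.injective_iff_surjective.mp hσ).range_comp P
  rw [← hrange]
  rcases h with h | h
  · exact Or.inl ⟨(hP.comp hσ).inB6 fun m => (h m).trans (conc₁_iff m).symm,
      (inModuli_iff exists_labels_of_mem_NB₁ _).2 ⟨_, hP.comp hσ, h, rfl⟩⟩
  · exact Or.inr ((inModuli_iff exists_labels_of_mem_NB₂ _).2 ⟨_, hP.comp hσ, h, rfl⟩)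

/-! ### The realizations of the second matroid -/

theorem exists_root : ∃ ω : ℂ, ω ^ 2 + ω + 1 = 0 := by
  obtain ⟨z, hz⟩ := IsAlgClosed.exists_pow_nat_eq (-3 : ℂ) (n := 2) (by norm_num)
  exact ⟨(z - 1) / 2, by linear_combination hz / 4⟩

theorem isRealization_joins_hessePoint {ω : ℂ} (hω : ω ^ 2 + ω + 1 = 0) :
    IsRealization NB₂ (joins (hessePoint ω)) :=
  (generic_hessePoint hω).isRealization_joins exists_labels_of_mem_NB₂ fun m =>
    (concurrent_hessePoint_iff hω m).trans (conc₂_iff m)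

theorem IsRealization.exists_labelledEquiv {L : Fin 15 → Line} (hL : IsRealization NB₂ L) :
    ∃ ω : ℂ, ω ^ 2 + ω + 1 = 0 ∧ LabelledEquiv L (joins (hessePoint ω)) := by
  obtain ⟨P, hP, rfl, hc⟩ := hL.exists_generic exists_labels_of_mem_NB₂
  obtain ⟨ω, hω, h, hh⟩ := hP.exists_hessePoint fun m => (hc m).trans (conc₂_iff m).symm
  exact ⟨ω, hω, hP.labelledEquiv_joins hh⟩

theorem card_realizationSpace_NB₂ : Nat.card (RealizationSpace NB₂) = 2 := by
  obtain ⟨ω, hω⟩ := exists_root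
  have hω' : (ω ^ 2) ^ 2 + ω ^ 2 + 1 = 0 := by grind
  have hne : ω ≠ ω ^ 2 := by grind
  let x : RealizationSpace NB₂ :=
    Quotient.mk (realizationSetoid NB₂) ⟨_, isRealization_joins_hessePoint hω⟩
  let y : RealizationSpace NB₂ :=
    Quotient.mk (realizationSetoid NB₂) ⟨_, isRealization_joins_hessePoint hω'⟩
  rw [Nat.card_eq_two_iff]
  refine ⟨x, y, fun hxy => ?_, Set.eq_univ_of_forall fun z => ?_⟩
  · have h : LabelledEquiv (joins (hessePoint ω)) (joins (hessePoint (ω ^ 2))) :=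
      Quotient.exact hxy
    obtain ⟨g, hg⟩ := (generic_hessePoint hω).exists_act_eq (generic_hessePoint hω') h
    exact hne (hessePoint_injective hg)
  · induction z using Quotient.inductionOn with | h L =>
    obtain ⟨ω', h', hL⟩ := L.2.exists_labelledEquiv
    rcases eq_or_eq_sq_of_root hω h' with rfl | rfl
    · exact Or.inl (Quotient.sound (s := realizationSetoid NB₂) hL)
    · exact Or.inr (Quotient.sound (s := realizationSetoid NB₂) hL)

theorem projEquiv_hesseType {j : ℂ} (hj : j ^ 2 + j + 1 = 0) :
    ProjEquiv (Set.range (hessePoint j)) (hesseType j) := by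
  -- the first two points and the last one of `hesseType j` form one of the two triangles; `M` sends
  -- the coordinate triangle to it and the unit point to the third point of `hesseType j`
  let M : Matrix (Fin 3) (Fin 3) ℂ :=
    !![-((1 - j) / 3), 0, (1 - j) / 3; 0, -((j + 2) / 3), (j + 2) / 3; 0, 0, 1]
  have hdet : M.det ≠ 0 := by
    rw [Matrix.det_fin_three]
    simp [M]
    grind
  have hinj : Function.Injective M.mulVecLin := by
    rwa [Matrix.coe_mulVecLin, Matrix.mulVec_injective_iff_isUnit, Matrix.isUnit_iff_isUnit_det,
      isUnit_iff_ne_zero]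
  let g := LinearEquiv.ofInjectiveEndo M.mulVecLin hinj
  have hg : ∀ v, g v = M.mulVec v := fun v => rfl
  have he : Function.Surjective (![0, 2, 1, 5, 3, 4] : Fin 6 → Fin 6) := by decide
  refine ⟨g, ?_⟩
  rw [← Set.range_comp, hesseType, ← he.range_comp]
  congr 1
  ext1 i
  simp only [Function.comp_apply]
  rw [hessePoint, act_mk, Projectivization.mk_eq_mk_iff']
  have hi : ∃ a : ℂ, a • hesseTypeNormal j i =
      M.mulVec (hesseNormal j ((![0, 2, 1, 5, 3, 4] : Fin 6 → Fin 6) i)) := by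
    refine ⟨(![-((1 - j) / 3), -((j + 2) / 3), 1, 1, 1, 1] : Fin 6 → ℂ) i, ?_⟩
    ext t
    fin_cases i <;> fin_cases t <;>
      simp [M, hesseNormal, hesseTypeNormal, Matrix.mulVec, dotProduct, Fin.sum_univ_three]
    all_goals grind
  exact hi

theorem inModuli_NB₂_iff {j : ℂ} (hj : j ^ 2 + j + 1 = 0) (C : Set Line) :
    InModuli NB₂ C ↔ ProjEquiv C (hesseType j) := by
  rw [inModuli_iff exists_labels_of_mem_NB₂]
  constructor
  · rintro ⟨P, hP, hc, rfl⟩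
    obtain ⟨ω, hω, h, hh⟩ := hP.exists_hessePoint fun m => (hc m).trans (conc₂_iff m).symm
    refine ProjEquiv.trans ⟨h, ?_⟩ (projEquiv_hesseType hj)
    rw [← Set.range_comp]
    have : act h ∘ P = hessePoint ω := funext hh
    rw [this]
    rcases eq_or_eq_sq_of_root hj hω with rfl | rfl
    · rfl
    · exact range_hessePoint_sq hj
  · intro hC
    obtain ⟨h, rfl⟩ := (projEquiv_hesseType hj).trans hC.symm
    refine ⟨act h ∘ hessePoint j, (generic_hessePoint hj).act h, fun m => ?_, ?_⟩
    · rw [(generic_hessePoint hj).concurrent_act_iff h (mate_ne m), concurrent_hessePoint_iff hj,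
        conc₂_iff]
    · rw [Set.range_comp]

theorem range_hessePoint_subset {j : ℂ} (hj : j ^ 2 + j + 1 = 0) :
    Set.range (hessePoint j) ⊆ hesseArrangement j := by
  have h3 : j ^ 3 = 1 := by linear_combination (j - 1) * hj
  have hj0 : j ≠ 0 := by rintro rfl; simp at h3
  have hscale : ∀ (v w : Fin 3 → ℂ) (hv : v ≠ 0) (a : ℂ), a ≠ 0 → w = a • v →
      ∃ hw : w ≠ 0, Projectivization.mk ℂ v hv = Projectivization.mk ℂ w hw := by
    rintro v w hv a ha rfl
    refine ⟨smul_ne_zero ha hv, ?_⟩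
    rw [eq_comm, Projectivization.mk_eq_mk_iff']
    exact ⟨a, rfl⟩
  rintro _ ⟨i, rfl⟩
  fin_cases i
  · exact ⟨_, _, rfl, Or.inl rfl⟩
  · exact ⟨_, _, rfl, Or.inr (Or.inr (Or.inr ⟨0, 0, by simp [hesseNormal]⟩))⟩
  · exact ⟨_, _, rfl, Or.inr (Or.inl rfl)⟩
  · obtain ⟨hw, h⟩ := hscale _ ![1, j ^ 1, j ^ 2] (hesseNormal_ne_zero j 3) (j ^ 2)
      (pow_ne_zero 2 hj0) (by ext t; fin_cases t <;> simp [hesseNormal] <;> grind)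
    exact ⟨_, hw, h, Or.inr (Or.inr (Or.inr ⟨1, 2, rfl⟩))⟩
  · exact ⟨_, _, rfl, Or.inr (Or.inr (Or.inl rfl))⟩
  · obtain ⟨hw, h⟩ := hscale _ ![1, j ^ 2, j ^ 1] (hesseNormal_ne_zero j 5) j
      hj0 (by ext t; fin_cases t <;> simp [hesseNormal] <;> grind)
    exact ⟨_, hw, h, Or.inr (Or.inr (Or.inr ⟨2, 1, rfl⟩))⟩

end Unassuming

theorem mainTheorem2 :
    -- every unassuming arrangement lies in one of the two moduli spaces
    (∀ C : Set Unassuming.Line, Unassuming.IsUnassuming C →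
      (Unassuming.InB6 C ∧ Unassuming.InModuli Unassuming.NB₁ C) ∨
        Unassuming.InModuli Unassuming.NB₂ C) ∧
    -- the labelled family is one-dimensional: distinct parameters give inequivalent members
    (∀ z z' : ℂ, z ∉ Unassuming.excluded → z' ∉ Unassuming.excluded →
      Unassuming.LabelledEquiv (Unassuming.familyLine z) (Unassuming.familyLine z') → z = z') ∧
    -- the second moduli space is rigid: the realization space consists of two points
    Nat.card (Unassuming.RealizationSpace Unassuming.NB₂) = 2 ∧
    -- forgetting the labels, it is the projective class of the Hesse-type arrangement
    (∀ j : ℂ, j ^ 2 + j + 1 = 0 →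
      (∀ C : Set Unassuming.Line, Unassuming.InModuli Unassuming.NB₂ C ↔
        Unassuming.ProjEquiv C (Unassuming.hesseType j)) ∧
      ∃ B ⊆ Unassuming.hesseArrangement j,
        Unassuming.ProjEquiv (Unassuming.hesseType j) B) := by
  refine ⟨fun C hC => hC.inB6_or_inModuli,
    fun z z' _ _ h => Unassuming.eq_of_labelledEquiv_familyLine h,
    Unassuming.card_realizationSpace_NB₂, fun j hj => ⟨Unassuming.inModuli_NB₂_iff hj, _,
      Unassuming.range_hessePoint_subset hj, (Unassuming.projEquiv_hesseType hj).symm⟩⟩
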